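/- For $f\in L^1(\mathbb R)$ (complex-valued) write $\hat f(k)=\int_{\mathbb R}e^{-ikx}f(x)\,dx$. For $s>0$ let $X_s$ be the set of $f\in L^1(\mathbb R)$ for which there is an $f^{(s)}\in L^1(\mathbb R)$ with $\widehat{f^{(s)}}(k)=(ik)^s\hat f(k)$ for all $k\in\mathbb R$ (principal branch of the power); such an $f^{(s)}$ is unique almost everywhere. Let $1<\alpha\le 2$. Let $(w_n)_{n\ge 0}$ be the real sequence determined by $$\sum_{i=0}^{m} w_i\,(m+1-i)^{\alpha-1}=\begin{cases}\Gamma(\alpha)& m=0,\\ 0& m\ge 1,\end{cases}$$ and for $h>0$ and $f\in L^1(\mathbb R)$ put $$A_h^\alpha f(x)=\frac1{h^\alpha}\sum_{n=-1}^\infty w_{n+1}\,f(x-nh).$$ **Theorem 3.1.** (a) Let $0\le\beta\le\alpha$. Then there exists a constant $C>0$, depending only on $\alpha$ and $\beta$, such that for every $f\in X_{\alpha+\beta}$ one has $f\in X_\alpha$ and, for every $h>0$, the series defining $A_h^\alpha f(x)$ converges absolutely for almost every $x$, $A_h^\alpha f\in L^1(\mathbb R)$, and $$\|A_h^\alpha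 f-f^{(\alpha)}\|_{L^1(\mathbb R)}\le C\,h^\beta\,\|f^{(\alpha+\beta)}\|_{L^1(\mathbb R)}.$$ (b) For every $f\in X_\alpha$, $\|A_h^\alpha f-f^{(\alpha)}\|_{L^1(\mathbb R)}\to 0$ as $h\downarrow 0$. -/

import Mathlib

open MeasureTheory Filter Topology

/-- The Fourier transform in the normalisation `f̂(k) = ∫ e^{-ikx} f(x) dx`. -/
noncomputable def fourierHat (f : ℝ → ℂ) (k : ℝ) : ℂ :=
  ∫ x : ℝ, Complex.exp (-(Complex.I * (k : ℂ) * (x : ℂ))) * f x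

/-- `f` and `g` are in `L¹(ℝ)` and `g = f^{(s)}` is the fractional derivative of order `s` of `f`,
that is `ĝ(k) = (ik)^s f̂(k)` for all real `k` (principal branch of the power).
So `f` is in the space `X_s` iff such a `g` exists, and then `g` is unique almost everywhere. -/
def IsFracDeriv (s : ℝ) (f g : ℝ → ℂ) : Prop :=
  Integrable f ∧ Integrable g ∧
    ∀ k : ℝ, fourierHat g k = (Complex.I * (k : ℂ)) ^ (s : ℂ) * fourierHat f k

/-- The weights `w_0, w_1, …`, obtained by forward substitution in the lower triangular system
stated in `schemeWeight_system`. -/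
noncomputable def schemeWeight (α : ℝ) : ℕ → ℝ
  | 0 => Real.Gamma α
  | m + 1 => -∑ i : Fin (m + 1), schemeWeight α i * ((m + 2 - i : ℕ) : ℝ) ^ (α - 1)

/-- Row `m + 1` of the system that determines the weights:
`w_m 1^{α-1} + w_{m-1} 2^{α-1} + ⋯ + w_0 (m+1)^{α-1}` is `Γ(α)` for `m = 0`, and `0` otherwise. -/
theorem schemeWeight_system (α : ℝ) (m : ℕ) :
    ∑ i ∈ Finset.range (m + 1), schemeWeight α i * ((m + 1 - i : ℕ) : ℝ) ^ (α - 1) =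
      if m = 0 then Real.Gamma α else 0 := by
  cases m with
  | zero => simp [schemeWeight]
  | succ m =>
    rw [Finset.sum_range_succ, schemeWeight,
      Finset.sum_range (fun i => schemeWeight α i * ((m + 1 + 1 - i : ℕ) : ℝ) ^ (α - 1))]
    simp

/-- The difference scheme `A_h^α f(x) = h^{-α} ∑_{n ≥ -1} w_{n+1} f(x - nh)`,
summed over `m = n + 1 ≥ 0`. -/
noncomputable def scheme (α h : ℝ) (f : ℝ → ℂ) (x : ℝ) : ℂ :=
  ((h ^ (-α) : ℝ) : ℂ) * ∑' m : ℕ, (schemeWeight α m : ℂ) * f (x - ((m : ℝ) - 1) * h)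

open scoped FourierTransform SchwartzMap ContDiff

/-! ### The Fourier transform on `L¹` -/

/-! The generating function `W(z) = ∑ w_m z^m` satisfies `W(z) ∑ (j+1)^(α-1) z^j = Γ(α)`. In Fourier
space the scheme therefore multiplies by `h^(-α) W(e^(-ihk)) e^(ihk) = (ik)^α φ(hk)`, where `φ(k) =
W(e^(-ik)) e^(ik) (ik)^(-α)` is `schemeSymbol`. Poisson summation of `t_+^(α-1) e^(-st)`
(Lipschitz's formula) gives `∑ (j+1)^(α-1) e^(-s(j+1)) = Γ(α) (s^(-α) + p(s))`, with `p` the lattice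
sum over `n ≠ 0`. Hence `φ(k) (1 + (ik)^α p(ik)) = 1` for `|k| ≤ 3`, and `φ - 1 = -(ik)^α p φ`
vanishes to order `α` at the origin.

The estimate in (a) says that `(φ(k) - 1)(ik)^(-β)` is a Fourier multiplier of `L¹`: dilations
preserve multiplier norms, and replacing `k` by `hk` produces exactly the factor `h^β`. At the
endpoints, `φ` and `(φ - 1)(ik)^(-α)` decay like `|k|^(-α)` together with their derivatives. As `α >
1`, they lie in `H¹`, so Plancherel and Cauchy-Schwarz make them transforms of `L¹` kernels.
Intermediate `β` follow by splitting frequencies with the rational filter `lowPass`. The remaining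
fractional factors come from `(ik/(1+ik))^γ = (1 - 1/(1+ik))^γ`, whose binomial series is absolutely
summable, while `1/(1+ik)` is a multiplier of norm at most one. The same splitting proves `X_(α+β) ⊆
X_α`.

All this needs `∑ (m+1)|w_m| < ∞`, so that `W` is `C¹` on the unit circle. Multiplication by
`(1-z)²` turns `∑ (j+1)^(α-1) z^j` into `1 - zQ(z)`, where `Q` has nonnegative coefficients with
partial sums at most one. For `α < 2` they are positive and log-convex, and Kaluza's argument makes
the coefficients `u` of `1/(1 - zQ)` log-convex, hence convex; for `α = 2` one has `Q = 0`. Since `0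
≤ u ≤ 1` and `W = Γ(α)(1-z)² U`, the weights are, from index two on, `Γ(α)` times second differences
of a bounded convex sequence, which are summable against `n`.

Part (b) is a density argument: `φ(h·) - 1` is a multiplier bounded uniformly in `h`, and on
Schwartz functions the case `β = 1` gives `O(h)`. -/

theorem fourierHat_eq_fourier (f : ℝ → ℂ) (k : ℝ) :
    fourierHat f k = 𝓕 f (k / (2 * Real.pi)) := by
  rw [fourierHat, Real.fourier_real_eq_integral_exp_smul]
  congr 1 with x
  rw [smul_eq_mul]
  congr 2
  have : (Real.pi : ℂ) ≠ 0 := by exact_mod_cast Real.pi_ne_zero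
  push_cast
  field_simp

theorem fourier_eq_fourierHat (f : ℝ → ℂ) (ξ : ℝ) :
    𝓕 f ξ = fourierHat f (2 * Real.pi * ξ) := by
  rw [fourierHat_eq_fourier]
  field_simp

theorem integrable_fourierHat_integrand {f : ℝ → ℂ} (hf : Integrable f) (k : ℝ) :
    Integrable fun x : ℝ => Complex.exp (-(Complex.I * (k : ℂ) * (x : ℂ))) * f x := by
  refine hf.bdd_mul (c := 1) (by fun_prop) (ae_of_all _ fun x => ?_)
  rw [Complex.norm_exp]
  simp

theorem fourierHat_add {f g : ℝ → ℂ} (hf : Integrable f) (hg : Integrable g) (k : ℝ) :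
    fourierHat (fun x => f x + g x) k = fourierHat f k + fourierHat g k := by
  simp only [fourierHat, mul_add]
  exact integral_add (integrable_fourierHat_integrand hf k) (integrable_fourierHat_integrand hg k)

theorem fourierHat_sub {f g : ℝ → ℂ} (hf : Integrable f) (hg : Integrable g) (k : ℝ) :
    fourierHat (fun x => f x - g x) k = fourierHat f k - fourierHat g k := by
  simp only [fourierHat, mul_sub]
  exact integral_sub (integrable_fourierHat_integrand hf k) (integrable_fourierHat_integrand hg k)

theorem fourierHat_const_mul (c : ℂ) (f : ℝ → ℂ) (k : ℝ) :
    fourierHat (fun x => c * f x) k = c * fourierHat f k := by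
  simp only [fourierHat, mul_left_comm _ c]
  exact integral_const_mul c _

theorem fourierHat_comp_sub_right (f : ℝ → ℂ) (a k : ℝ) :
    fourierHat (fun x => f (x - a)) k =
      Complex.exp (-(Complex.I * k * a)) * fourierHat f k := by
  simp only [fourierHat]
  rw [← integral_const_mul, ← integral_sub_right_eq_self
    (fun x : ℝ => Complex.exp (-(Complex.I * k * a)) * (Complex.exp (-(Complex.I * k * x)) * f x)) a]
  congr 1 with x
  rw [← mul_assoc, ← Complex.exp_add]
  congr 2
  push_cast
  ring

theorem fourierHat_comp_mul_left (f : ℝ → ℂ) {a : ℝ} (ha : 0 < a) (k : ℝ) :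
    fourierHat (fun x => f (a * x)) k = (a : ℂ)⁻¹ * fourierHat f (k / a) := by
  simp only [fourierHat]
  have h := Measure.integral_comp_mul_left
    (fun x : ℝ => Complex.exp (-(Complex.I * ((k / a : ℝ) : ℂ) * (x : ℂ))) * f x) a
  have h2 : ((a : ℂ)⁻¹) = ((|a⁻¹| : ℝ) : ℂ) := by
    rw [abs_of_pos (inv_pos.mpr ha), Complex.ofReal_inv]
  rw [h2, ← Complex.real_smul, ← h]
  congr 1 with x
  have : (a : ℂ) ≠ 0 := by exact_mod_cast ha.ne'
  congr 3
  push_cast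
  field_simp

theorem continuous_fourierHat {f : ℝ → ℂ} (hf : Integrable f) : Continuous (fourierHat f) := by
  have h : fourierHat f = fun k => 𝓕 f (k / (2 * Real.pi)) :=
    funext fun k => fourierHat_eq_fourier f k
  rw [h]
  have h2 : Continuous (𝓕 f) :=
    VectorFourier.fourierIntegral_continuous Real.continuous_fourierChar
      (by exact continuous_inner) hf
  exact h2.comp (continuous_id.div_const _)

theorem integral_schwartz_mul_fourier (g : 𝓢(ℝ, ℂ)) {f : ℝ → ℂ} (hf : Integrable f) :
    ∫ x, (𝓕 g) x * f x = ∫ x, g x * 𝓕 f x := by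
  have := VectorFourier.integral_fourierIntegral_smul_eq_flip (𝕜 := ℝ) (μ := volume)
    (ν := volume) (e := Real.fourierChar) (L := innerₗ ℝ) (f := (g : ℝ → ℂ)) (g := f)
    Real.continuous_fourierChar (by exact continuous_inner) g.integrable hf
  rw [flip_innerₗ] at this
  exact this

theorem ae_eq_zero_of_integral_schwartz_mul_eq_zero {f : ℝ → ℂ} (hf : LocallyIntegrable f)
    (h : ∀ g : 𝓢(ℝ, ℂ), ∫ x, g x * f x = 0) : f =ᵐ[volume] 0 := by
  refine ae_eq_zero_of_integral_contDiff_smul_eq_zero hf fun g hg hc => ?_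
  have hg₁ : HasCompactSupport (Complex.ofRealCLM ∘ g) := hc.comp_left rfl
  have hg₂ : ContDiff ℝ ∞ (Complex.ofRealCLM ∘ g) := by fun_prop
  rw [← h (hg₁.toSchwartzMap hg₂)]
  congr 1

/-- An integrable function is determined by its Fourier transform off the origin. -/
theorem ae_eq_of_fourierHat_eq {f g : ℝ → ℂ} (hf : Integrable f) (hg : Integrable g)
    (h : ∀ k : ℝ, k ≠ 0 → fourierHat f k = fourierHat g k) : f =ᵐ[volume] g := by
  -- Transforms of integrable functions are continuous, so equality off the origin extends to the
  -- origin.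
  have hz : ∀ k, fourierHat (fun x => f x - g x) k = 0 := by
    have hc : Continuous (fourierHat (fun x => f x - g x)) := continuous_fourierHat (hf.sub hg)
    have hd : Dense ({0}ᶜ : Set ℝ) := dense_compl_singleton 0
    intro k
    refine congrFun (hc.ext_on hd (continuous_const (y := (0 : ℂ))) fun k hk => ?_) k
    rw [fourierHat_sub hf hg, h k hk, sub_self]
  have h0 : (fun x => f x - g x) =ᵐ[volume] 0 := by
    refine ae_eq_zero_of_integral_schwartz_mul_eq_zero (hf.sub hg).locallyIntegrable fun φ => ?_
    have := integral_schwartz_mul_fourier (𝓕⁻ φ) (hf.sub hg)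
    rw [FourierTransform.fourier_fourierInv_eq] at this
    rw [show (∫ x, φ x * (f x - g x)) = ∫ x, φ x * (f - g) x from rfl, this]
    have hF : 𝓕 (f - g) = 0 := by
      ext ξ
      rw [fourier_eq_fourierHat]
      exact hz _
    simp [hF]
  filter_upwards [h0] with x hx
  exact sub_eq_zero.mp hx

/-- **Plancherel's theorem**: the Fourier integral of a function in `L¹ ∩ L²` is in `L²`. -/
theorem memLp_two_fourier {f : ℝ → ℂ} (hf : Integrable f) (hf2 : MemLp f 2) :
    MemLp (𝓕 f) 2 := by
  set F : Lp ℂ 2 (volume : Measure ℝ) := 𝓕 (hf2.toLp f) with hF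
  have hc : Continuous (𝓕 f) :=
    VectorFourier.fourierIntegral_continuous Real.continuous_fourierChar
      (by exact continuous_inner) hf
  -- The `L²` transform and the Fourier integral are both locally integrable and act identically on
  -- every Schwartz function.
  have key : (fun x => F x - 𝓕 f x) =ᵐ[volume] 0 := by
    have hFl : LocallyIntegrable F := (Lp.memLp F).locallyIntegrable (by norm_num)
    refine ae_eq_zero_of_integral_schwartz_mul_eq_zero
      (hFl.sub hc.locallyIntegrable) fun g => ?_
    have h1 := Lp.fourier_toTemperedDistribution_eq (E := ℝ) (F := ℂ) (hf2.toLp f)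
    have h2 : (𝓕 ((hf2.toLp f : Lp ℂ 2 (volume : Measure ℝ)) : 𝓢'(ℝ, ℂ))) g = (F : 𝓢'(ℝ, ℂ)) g := by rw [h1]
    simp only [TemperedDistribution.fourier_apply, Lp.toTemperedDistribution_apply,
      smul_eq_mul] at h2
    have h3 : ∫ x, (𝓕 g) x * (hf2.toLp f) x = ∫ x, (𝓕 g) x * f x := by
      apply integral_congr_ae
      filter_upwards [hf2.coeFn_toLp] with x hx
      rw [hx]
    rw [h3, integral_schwartz_mul_fourier g hf] at h2
    have i1 : Integrable fun x => g x * F x := by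
      have := (MemLp.integrable_mul (p := 2) (q := 2) (g.memLp 2) (Lp.memLp F))
      exact this
    have i2 : Integrable fun x => g x * 𝓕 f x := by
      refine Integrable.mul_bdd (c := ∫ x, ‖f x‖) g.integrable hc.aestronglyMeasurable
        (ae_of_all _ fun x => ?_)
      exact VectorFourier.norm_fourierIntegral_le_integral_norm _ _ _ _ _
    simp only [mul_sub]
    rw [integral_sub i1 i2, h2, sub_self]
  refine (Lp.memLp F).ae_eq ?_
  filter_upwards [key] with x hx
  exact sub_eq_zero.mp hx

/-! ### Series and convolutions in `L¹` -/

theorem ae_summable_of_summable_integral_norm {g : ℕ → ℝ → ℂ} (hg : ∀ n, Integrable (g n))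
    (hs : Summable fun n => ∫ x, ‖g n x‖) : ∀ᵐ x, Summable fun n => ‖g n x‖ := by
  have h1 : ∫⁻ x, ∑' n, ‖g n x‖ₑ ≠ ⊤ := by
    rw [lintegral_tsum fun n => (hg n).1.enorm]
    have : ∀ n, ∫⁻ x, ‖g n x‖ₑ = ENNReal.ofReal (∫ x, ‖g n x‖) := fun n => by
      rw [ofReal_integral_norm_eq_lintegral_enorm (hg n)]
    simp only [this]
    exact hs.tsum_ofReal_ne_top
  filter_upwards [ae_lt_top' (AEMeasurable.tsum fun n => (hg n).1.enorm) h1] with x hx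
  exact ENNReal.tsum_coe_ne_top_iff_summable_coe.mp hx.ne

theorem integrable_tsum_of_summable_integral_norm {g : ℕ → ℝ → ℂ} (hg : ∀ n, Integrable (g n))
    (hs : Summable fun n => ∫ x, ‖g n x‖) :
    Integrable (fun x => ∑' n, g n x) ∧ ∫ x, ‖∑' n, g n x‖ ≤ ∑' n, ∫ x, ‖g n x‖ := by
  have hae := ae_summable_of_summable_integral_norm hg hs
  have hn : ∀ n, Integrable fun x => ‖g n x‖ := fun n => (hg n).norm
  have hs' : Summable fun n => ∫ x, ‖‖g n x‖‖ := by simpa using hs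
  have hint : ∫ x, ∑' n, ‖g n x‖ = ∑' n, ∫ x, ‖g n x‖ :=
    (integral_tsum_of_summable_integral_norm hn hs').symm
  have h1 : ∫⁻ x, ∑' n, ‖g n x‖ₑ < ⊤ := by
    rw [lintegral_tsum fun n => (hg n).1.enorm]
    have : ∀ n, ∫⁻ x, ‖g n x‖ₑ = ENNReal.ofReal (∫ x, ‖g n x‖) := fun n => by
      rw [ofReal_integral_norm_eq_lintegral_enorm (hg n)]
    simp only [this]
    exact hs.tsum_ofReal_lt_top
  have hmeas : AEStronglyMeasurable (fun x => ∑' n, g n x) := by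
    refine aestronglyMeasurable_of_tendsto_ae atTop
      (f := fun (N : ℕ) x => ∑ n ∈ Finset.range N, g n x)
      (fun N => Finset.aestronglyMeasurable_fun_sum _ fun n _ => (hg n).1) ?_
    filter_upwards [hae] with x hx
    exact hx.of_norm.hasSum.tendsto_sum_nat
  have hmeas' : AEStronglyMeasurable (fun x => ∑' n, ‖g n x‖) := by
    refine aestronglyMeasurable_of_tendsto_ae atTop
      (f := fun (N : ℕ) x => ∑ n ∈ Finset.range N, ‖g n x‖)
      (fun N => Finset.aestronglyMeasurable_fun_sum _ fun n _ => (hn n).1) ?_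
    filter_upwards [hae] with x hx
    exact hx.hasSum.tendsto_sum_nat
  have hle : ∀ᵐ x, ‖∑' n, g n x‖ ≤ ∑' n, ‖g n x‖ := by
    filter_upwards [hae] with x hx
    exact norm_tsum_le_tsum_norm hx
  have hI : Integrable fun x => ∑' n, ‖g n x‖ := by
    refine ⟨hmeas', ?_⟩
    rw [hasFiniteIntegral_iff_enorm]
    refine lt_of_le_of_lt (lintegral_mono_ae ?_) h1
    filter_upwards [hae] with x hx
    rw [Real.enorm_of_nonneg (tsum_nonneg fun n => norm_nonneg _),
      ENNReal.ofReal_tsum_of_nonneg (fun n => norm_nonneg _) hx]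
    exact le_of_eq (tsum_congr fun n => ofReal_norm _)
  have hI' : Integrable fun x => ∑' n, g n x := by
    refine hI.mono' hmeas hle
  exact ⟨hI', hint ▸ integral_mono_ae hI'.norm hI hle⟩

theorem hasSum_fourierHat {g : ℕ → ℝ → ℂ} (hg : ∀ n, Integrable (g n))
    (hs : Summable fun n => ∫ x, ‖g n x‖) (k : ℝ) :
    HasSum (fun n => fourierHat (g n) k) (fourierHat (fun x => ∑' n, g n x) k) := by
  have h := hasSum_integral_of_summable_integral_norm
    (F := fun n (x : ℝ) => Complex.exp (-(Complex.I * (k : ℂ) * (x : ℂ))) * g n x) (μ := volume)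
    (fun n => integrable_fourierHat_integrand (hg n) k) (by
      refine hs.congr fun n => ?_
      congr 1 with x
      rw [norm_mul, Complex.norm_exp]
      simp)
  simp only [tsum_mul_left] at h
  exact h

theorem integral_norm_convolution_le {f g : ℝ → ℂ} (hf : Integrable f) (hg : Integrable g) :
    ∫ x, ‖(convolution f g (ContinuousLinearMap.mul ℂ ℂ) volume) x‖ ≤
      (∫ x, ‖f x‖) * ∫ x, ‖g x‖ := by
  have h := integral_convolution (μ := volume) (ν := volume) (ContinuousLinearMap.mul ℝ ℝ)
    hf.norm hg.norm
  rw [ContinuousLinearMap.mul_apply'] at h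
  rw [← h]
  refine integral_mono (hf.integrable_convolution _ hg).norm
    (hf.norm.integrable_convolution _ hg.norm) fun x => ?_
  refine (norm_integral_le_integral_norm _).trans (le_of_eq ?_)
  simp [convolution]

/-! ### Multipliers of `L¹` -/

/-- Multiplication of the Fourier transform by `m` is a bounded operator on `L¹(ℝ)`, of norm at
most `C`. The value `m 0` does not matter. -/
def IsL1Multiplier (C : ℝ) (m : ℝ → ℂ) : Prop :=
  0 ≤ C ∧ ∀ f : ℝ → ℂ, Integrable f → ∃ g : ℝ → ℂ, Integrable g ∧
    (∀ k : ℝ, k ≠ 0 → fourierHat g k = m k * fourierHat f k) ∧ ∫ x, ‖g x‖ ≤ C * ∫ x, ‖f x‖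

namespace IsL1Multiplier

theorem congr {C : ℝ} {m m' : ℝ → ℂ} (h : IsL1Multiplier C m) (hm : ∀ k, k ≠ 0 → m' k = m k) :
    IsL1Multiplier C m' := by
  refine ⟨h.1, fun f hf => ?_⟩
  obtain ⟨g, hg, hgk, hgn⟩ := h.2 f hf
  exact ⟨g, hg, fun k hk => by rw [hgk k hk, hm k hk], hgn⟩

theorem const (c : ℂ) : IsL1Multiplier ‖c‖ fun _ => c := by
  refine ⟨norm_nonneg c, fun f hf => ⟨fun x => c * f x, hf.const_mul c, fun k _ => ?_, ?_⟩⟩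
  · exact fourierHat_const_mul c f k
  · simp [integral_const_mul]

theorem add {C D : ℝ} {m n : ℝ → ℂ} (hm : IsL1Multiplier C m) (hn : IsL1Multiplier D n) :
    IsL1Multiplier (C + D) fun k => m k + n k := by
  refine ⟨add_nonneg hm.1 hn.1, fun f hf => ?_⟩
  obtain ⟨g, hg, hgk, hgn⟩ := hm.2 f hf
  obtain ⟨g', hg', hgk', hgn'⟩ := hn.2 f hf
  refine ⟨fun x => g x + g' x, hg.add hg', fun k hk => ?_, ?_⟩
  · rw [fourierHat_add hg hg', hgk k hk, hgk' k hk, add_mul]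
  · calc ∫ x, ‖g x + g' x‖ ≤ ∫ x, (‖g x‖ + ‖g' x‖) :=
          integral_mono (hg.add hg').norm (hg.norm.add hg'.norm) fun x => norm_add_le _ _
      _ = (∫ x, ‖g x‖) + ∫ x, ‖g' x‖ := integral_add hg.norm hg'.norm
      _ ≤ _ := by rw [add_mul]; exact add_le_add hgn hgn'

theorem mul {C D : ℝ} {m n : ℝ → ℂ} (hm : IsL1Multiplier C m) (hn : IsL1Multiplier D n) :
    IsL1Multiplier (C * D) fun k => m k * n k := by
  refine ⟨mul_nonneg hm.1 hn.1, fun f hf => ?_⟩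
  obtain ⟨g', hg', hgk', hgn'⟩ := hn.2 f hf
  obtain ⟨g, hg, hgk, hgn⟩ := hm.2 g' hg'
  refine ⟨g, hg, fun k hk => ?_, ?_⟩
  · rw [hgk k hk, hgk' k hk, mul_assoc]
  · rw [mul_assoc]
    exact hgn.trans (mul_le_mul_of_nonneg_left hgn' hm.1)

theorem const_mul {C : ℝ} {m : ℝ → ℂ} (hm : IsL1Multiplier C m) (c : ℂ) :
    IsL1Multiplier (‖c‖ * C) fun k => c * m k :=
  (const c).mul hm

theorem pow {C : ℝ} {m : ℝ → ℂ} (hm : IsL1Multiplier C m) (n : ℕ) :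
    IsL1Multiplier (C ^ n) fun k => m k ^ n := by
  induction n with
  | zero => simpa using const 1
  | succ n ih => simpa only [pow_succ] using ih.mul hm

theorem of_fourierHat {K : ℝ → ℂ} (hK : Integrable K) :
    IsL1Multiplier (∫ x, ‖K x‖) (fourierHat K) := by
  refine ⟨integral_nonneg fun x => norm_nonneg _, fun f hf => ⟨_,
    hK.integrable_convolution (ContinuousLinearMap.mul ℂ ℂ) hf, fun k _ => ?_,
    integral_norm_convolution_le hK hf⟩⟩
  simp only [fourierHat_eq_fourier]
  exact Real.fourier_mul_convolution_eq hK hf _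

theorem hasSum {C : ℕ → ℝ} {m : ℕ → ℝ → ℂ} {M : ℝ → ℂ} (hm : ∀ n, IsL1Multiplier (C n) (m n))
    (hC : Summable C) (hM : ∀ k, k ≠ 0 → HasSum (fun n => m n k) (M k)) :
    IsL1Multiplier (∑' n, C n) M := by
  refine ⟨tsum_nonneg fun n => (hm n).1, fun f hf => ?_⟩
  choose g hg hgk hgn using fun n => (hm n).2 f hf
  have hs : Summable fun n => ∫ x, ‖g n x‖ :=
    Summable.of_nonneg_of_le (fun n => integral_nonneg fun x => norm_nonneg _) hgn
      (hC.mul_right _)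
  obtain ⟨hI, hle⟩ := integrable_tsum_of_summable_integral_norm hg hs
  refine ⟨fun x => ∑' n, g n x, hI, fun k hk => ?_, ?_⟩
  · refine (hasSum_fourierHat hg hs k).unique ?_
    simp only [fun n => hgk n k hk]
    exact (hM k hk).mul_right _
  · refine hle.trans ?_
    rw [← tsum_mul_right]
    exact hs.tsum_le_tsum hgn (hC.mul_right _)

/-- Conjugation by a dilation scales the `L¹` norm by a factor that cancels on the way back. This is
what makes all constants independent of `h`. -/
theorem comp_mul {C : ℝ} {m : ℝ → ℂ} (hm : IsL1Multiplier C m) {h : ℝ} (hh : 0 < h) :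
    IsL1Multiplier C fun k => m (h * k) := by
  refine ⟨hm.1, fun f hf => ?_⟩
  obtain ⟨g, hg, hgk, hgn⟩ := hm.2 (fun x => f (h * x)) (hf.comp_mul_left' hh.ne')
  have hh' : (h : ℂ) ≠ 0 := by exact_mod_cast hh.ne'
  refine ⟨fun x => g (h⁻¹ * x), hg.comp_mul_left' (inv_ne_zero hh.ne'), fun k hk => ?_, ?_⟩
  · rw [fourierHat_comp_mul_left _ (inv_pos.mpr hh), div_inv_eq_mul, mul_comm k h,
      hgk _ (mul_ne_zero hh.ne' hk), fourierHat_comp_mul_left _ hh, mul_div_cancel_left₀ _ hh.ne']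
    push_cast
    field_simp
  · have e1 := Measure.integral_comp_mul_left (fun x => ‖g x‖) h⁻¹
    have e2 := Measure.integral_comp_mul_left (fun x => ‖f x‖) h
    rw [e2] at hgn
    rw [e1, inv_inv, abs_of_pos hh]
    rw [abs_of_pos (inv_pos.mpr hh)] at hgn
    simp only [smul_eq_mul] at hgn ⊢
    calc _ ≤ h * (C * (h⁻¹ * ∫ x, ‖f x‖)) := by gcongr
      _ = _ := by field_simp

end IsL1Multiplier

/-! ### Functions in `H¹` have integrable Fourier transforms -/

theorem memLp_two_one_add_abs_rpow_neg {r : ℝ} (hr : 1 / 2 < r) :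
    MemLp (fun x : ℝ => (1 + |x|) ^ (-r)) 2 := by
  have hc : Continuous fun x : ℝ => (1 + |x|) ^ (-r) :=
    (by fun_prop : Continuous fun x : ℝ => 1 + |x|).rpow_const fun x => Or.inl (by positivity)
  rw [memLp_two_iff_integrable_sq_norm hc.aestronglyMeasurable]
  have h := integrable_one_add_norm (E := ℝ) (μ := volume) (r := 2 * r) (by simp; linarith)
  refine h.congr (ae_of_all _ fun x => ?_)
  have : 0 < 1 + |x| := by positivity
  simp only [Real.norm_eq_abs]
  rw [sq_abs, ← Real.rpow_natCast, ← Real.rpow_mul this.le]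
  congr 1
  push_cast
  ring

theorem integrable_one_add_abs_rpow_neg {r : ℝ} (hr : 1 < r) :
    Integrable fun x : ℝ => (1 + |x|) ^ (-r) := by
  have h := integrable_one_add_norm (E := ℝ) (μ := volume) (r := r) (by simpa using hr)
  simpa using h

/-- By Plancherel for `m` and its derivative, `(1 + |x|) 𝓕 m` is in `L²`. Pairing it with `(1 +
|x|)⁻¹`, also in `L²`, gives integrability by Cauchy-Schwarz. -/
theorem integrable_fourier_of_memLp_two {m : ℝ → ℂ} (hd : Differentiable ℝ m)
    (hm : Integrable m) (hm2 : MemLp m 2) (hm' : Integrable (deriv m))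
    (hm'2 : MemLp (deriv m) 2) : Integrable (𝓕 m) := by
  have h1 := memLp_two_fourier hm hm2
  have h2 := memLp_two_fourier hm' hm'2
  rw [Real.fourier_deriv hm hd hm'] at h2
  have hb : MemLp (fun x : ℝ => ((1 + |x| : ℝ) : ℂ) * 𝓕 m x) 2 := by
    have h3 : MemLp (fun x : ℝ => ‖𝓕 m x‖ + ‖(2 * Real.pi * Complex.I * x) • (𝓕 m x)‖) 2 :=
      h1.norm.add h2.norm
    refine h3.mono ?_ (ae_of_all _ fun x => ?_)
    · exact (by fun_prop : Continuous fun x : ℝ => ((1 + |x| : ℝ) : ℂ)).aestronglyMeasurable.mul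
        h1.1
    · have h0 : (0 : ℝ) ≤ 1 + |x| := by positivity
      rw [norm_mul, Complex.norm_real, Real.norm_of_nonneg h0, norm_smul,
        Real.norm_of_nonneg (by positivity)]
      simp only [norm_mul, Complex.norm_real, Complex.norm_I, Real.norm_eq_abs,
        abs_of_pos Real.pi_pos, Complex.norm_ofNat, mul_one]
      have : |x| ≤ 2 * Real.pi * |x| := by
        have := Real.pi_gt_three
        nlinarith [abs_nonneg x]
      nlinarith [norm_nonneg (𝓕 m x)]
  have hc := (memLp_two_one_add_abs_rpow_neg (r := 1) (by norm_num)).ofReal (K := ℂ)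
  have := MemLp.integrable_mul (p := 2) (q := 2) hc hb
  refine this.congr (ae_of_all _ fun x => ?_)
  have h0 : (1 + |x| : ℝ) ≠ 0 := by positivity
  have h0' : ((1 + |x| : ℝ) : ℂ) ≠ 0 := by exact_mod_cast h0
  simp only [Pi.mul_apply, Real.rpow_neg_one]
  rw [← mul_assoc]
  have : ((((1 + |x|)⁻¹ : ℝ)) : ℂ) * ((1 + |x| : ℝ) : ℂ) = 1 := by
    rw [← Complex.ofReal_mul, inv_mul_cancel₀ h0, Complex.ofReal_one]
  exact (congrArg (· * 𝓕 m x) this).trans (one_mul _)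

/-- A function that decays, together with its derivative, like `|k|^(-r)` for some `r > 1` is the
Fourier transform of an integrable function. -/
theorem exists_fourierHat_eq_of_decay {m : ℝ → ℂ} {C r : ℝ} (hr : 1 < r)
    (hd : Differentiable ℝ m) (hm : ∀ k, ‖m k‖ ≤ C * (1 + |k|) ^ (-r))
    (hm' : ∀ k, ‖deriv m k‖ ≤ C * (1 + |k|) ^ (-r)) :
    ∃ K : ℝ → ℂ, Integrable K ∧ ∀ k, fourierHat K k = m k := by
  have hpi : (2 * Real.pi) ≠ 0 := by positivity
  have i1 : Integrable m :=
    ((integrable_one_add_abs_rpow_neg hr).const_mul C).mono' hd.continuous.aestronglyMeasurable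
      (ae_of_all _ hm)
  have meas' : AEStronglyMeasurable (deriv m) := (measurable_deriv m).aestronglyMeasurable
  have i1' : Integrable (deriv m) :=
    ((integrable_one_add_abs_rpow_neg hr).const_mul C).mono' meas' (ae_of_all _ hm')
  have hb := (memLp_two_one_add_abs_rpow_neg (r := r) (by linarith)).const_mul C
  have i2 : MemLp m 2 := hb.mono hd.continuous.aestronglyMeasurable
    (ae_of_all _ fun k => (hm k).trans (le_abs_self _))
  have i2' : MemLp (deriv m) 2 := hb.mono meas'
    (ae_of_all _ fun k => (hm' k).trans (le_abs_self _))
  have hF := integrable_fourier_of_memLp_two hd i1 i2 i1' i2'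
  have hFi : Integrable (𝓕⁻ m) := by
    have : 𝓕⁻ m = fun x => 𝓕 m (-x) := funext fun x => Real.fourierInv_eq_fourier_neg m x
    rw [this]
    exact hF.comp_neg
  have key := hd.continuous.fourier_fourierInv_eq i1 hF
  -- The kernel is the inverse transform of `m`; the factors of `2π` convert between the two
  -- normalisations.
  refine ⟨fun x => ((2 * Real.pi : ℝ) : ℂ)⁻¹ * 𝓕⁻ m ((2 * Real.pi)⁻¹ * x),
    (hFi.comp_mul_left' (inv_ne_zero hpi)).const_mul _, fun k => ?_⟩
  rw [fourierHat_const_mul, fourierHat_comp_mul_left _ (by positivity), div_inv_eq_mul,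
    mul_comm k, ← fourier_eq_fourierHat, key, ← mul_assoc]
  rw [Complex.ofReal_inv, inv_inv, inv_mul_cancel₀, one_mul]
  exact_mod_cast hpi

/-! ### Log-convex sequences and renewal sequences -/

theorem div_le_div_of_logConvex {u : ℕ → ℝ} (hu : ∀ n, 0 < u n) {n : ℕ}
    (h : ∀ m < n, u (m + 1) ^ 2 ≤ u m * u (m + 2)) {i : ℕ} (hi : i ≤ n) :
    u (i + 1) / u i ≤ u (n + 1) / u n := by
  induction n with
  | zero => obtain rfl : i = 0 := by omega
            exact le_rfl
  | succ n ih =>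
    rcases Nat.lt_or_ge n i with hlt | hge
    · obtain rfl : i = n + 1 := by omega
      exact le_rfl
    · refine (ih (fun m hm => h m (by omega)) hge).trans ?_
      rw [div_le_div_iff₀ (hu _) (hu _)]
      have := h n (by omega)
      nlinarith

/-- If `q` is positive and log-convex, so is the sequence with generating function
`1 / (1 - z Q(z))`. -/
theorem renewal_logConvex {q u : ℕ → ℝ} (hq : ∀ n, 0 < q n)
    (hqc : ∀ n, q (n + 1) ^ 2 ≤ q n * q (n + 2)) (hu : ∀ n, 0 < u n) (hu0 : u 0 = 1)
    (hrec : ∀ n, u (n + 1) = ∑ k ∈ Finset.range (n + 1), q (n - k) * u k) (n : ℕ) :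
    u (n + 1) ^ 2 ≤ u n * u (n + 2) := by
  induction n using Nat.strong_induction_on with
  | _ n ih =>
  -- Subtracting `l` times one renewal equation from the next leaves a recurrence for `u (k+1) - l *
  -- u k`.
  have step : ∀ (l : ℝ) (n : ℕ), u (n + 2) - l * u (n + 1) =
      q (n + 1) + ∑ k ∈ Finset.range (n + 1), q (n - k) * (u (k + 1) - l * u k) := by
    intro l n
    have h1 := hrec (n + 1)
    rw [Finset.sum_range_succ'] at h1
    simp only [Nat.add_sub_add_right, Nat.sub_zero, hu0, mul_one] at h1
    simp only [mul_sub, Finset.sum_sub_distrib]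
    rw [h1, hrec n, Finset.mul_sum]
    simp only [mul_left_comm l]
    ring
  cases n with
  | zero =>
    have h1 := hrec 0
    have h2 := hrec 1
    simp only [Finset.sum_range_succ, Finset.sum_range_zero, hu0] at h1 h2
    simp only [hu0, h1, h2, zero_add]
    have := hq 1
    norm_num at *
    nlinarith
  | succ j =>
    -- With `l` the latest ratio, monotonicity of the earlier ratios makes all these differences
    -- nonpositive, and the latest one zero.
    set l := u (j + 2) / u (j + 1) with hl
    have hle : ∀ i ≤ j + 1, u (i + 1) - l * u i ≤ 0 := by
      intro i hi
      have := div_le_div_of_logConvex hu ih hi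
      rw [div_le_iff₀ (hu i)] at this
      linarith
    have hz : u (j + 2) - l * u (j + 1) = 0 := by
      rw [hl, div_mul_cancel₀ _ (hu _).ne', sub_self]
    have e1 := step l j
    have e2 := step l (j + 1)
    rw [Finset.sum_range_succ] at e2
    simp only [add_assoc] at e1 e2 hz
    norm_num at e1 e2 hz
    rw [hz] at e1 e2
    -- By log-convexity `r` dominates all earlier ratios of `q`. As the differences are nonpositive,
    -- the right-hand side of `e2` is at least `r` times that of `e1`, which is zero.
    set r := q (j + 2) / q (j + 1) with hr
    have hr' : q (j + 2) = r * q (j + 1) := by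
      rw [hr, div_mul_cancel₀ _ (hq _).ne']
    have hsum : r * ∑ k ∈ Finset.range (j + 1), q (j - k) * (u (k + 1) - l * u k) ≤
        ∑ k ∈ Finset.range (j + 1), q (j + 1 - k) * (u (k + 1) - l * u k) := by
      rw [Finset.mul_sum]
      refine Finset.sum_le_sum fun k hk => ?_
      have hk' : k ≤ j := by simpa [Nat.lt_succ_iff] using hk
      have h1 := div_le_div_of_logConvex hq (n := j + 1) (i := j - k) (fun m _ => hqc m) (by omega)
      rw [div_le_iff₀ (hq _)] at h1
      rw [show j + 1 - k = j - k + 1 by omega, ← mul_assoc]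
      exact mul_le_mul_of_nonpos_right h1 (hle k (by omega))
    have h3 : 0 ≤ u (j + 3) - l * u (j + 2) := by
      have : r * (q (j + 1) + ∑ k ∈ Finset.range (j + 1), q (j - k) * (u (k + 1) - l * u k)) = 0 := by
        rw [← e1, mul_zero]
      rw [mul_add, ← hr'] at this
      rw [e2]
      linarith
    have h4 : l * u (j + 1) = u (j + 2) := by rw [hl, div_mul_cancel₀ _ (hu _).ne']
    have := mul_nonneg (hu (j + 1)).le h3
    change u (j + 2) ^ 2 ≤ u (j + 1) * u (j + 3)
    calc u (j + 2) ^ 2 = u (j + 1) * (l * u (j + 2)) := by rw [← h4]; ring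
      _ ≤ u (j + 1) * u (j + 3) := mul_le_mul_of_nonneg_left (by linarith) (hu _).le

theorem convex_of_logConvex {u : ℕ → ℝ} (hu : ∀ n, 0 < u n)
    (h : ∀ n, u (n + 1) ^ 2 ≤ u n * u (n + 2)) (n : ℕ) :
    0 ≤ u n - 2 * u (n + 1) + u (n + 2) := by
  have := h n
  have h2 : (2 * u (n + 1)) ^ 2 ≤ (u n + u (n + 2)) ^ 2 := by
    nlinarith [sq_nonneg (u n - u (n + 2))]
  have := abs_le_of_sq_le_sq' h2 (by linarith [hu n, hu (n + 2)])
  linarith [this.2]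

/-- Second differences of a bounded convex sequence are summable against `n`. -/
theorem summable_mul_second_difference {u : ℕ → ℝ} (h0 : ∀ n, 0 ≤ u n) (h1 : ∀ n, u n ≤ 1)
    (hc : ∀ n, 0 ≤ u n - 2 * u (n + 1) + u (n + 2)) :
    Summable fun n : ℕ => ((n : ℝ) + 1) * (u n - 2 * u (n + 1) + u (n + 2)) := by
  have hanti : Antitone fun n => u n - u (n + 1) := by
    refine antitone_nat_of_succ_le fun n => ?_
    have := hc n
    linarith
  -- A convex sequence that increases once grows at least linearly from there, contradicting the
  -- bound by one.
  have hpos : ∀ n, 0 ≤ u n - u (n + 1) := by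
    intro n
    by_contra! hneg
    have hlin : ∀ j : ℕ, u n + j * (u (n + 1) - u n) ≤ u (n + j) := by
      intro j
      induction j with
      | zero => simp
      | succ j ih =>
        have : u (n + j) - u (n + j + 1) ≤ u n - u (n + 1) := hanti (Nat.le_add_right n j)
        push_cast
        rw [← add_assoc]
        linarith
    obtain ⟨j, hj⟩ := exists_nat_gt (1 / (u (n + 1) - u n))
    rw [div_lt_iff₀ (by linarith)] at hj
    linarith [hlin j, h0 n, h1 (n + j)]
  have hsum : ∀ N : ℕ, ∑ n ∈ Finset.range N, ((n : ℝ) + 1) * (u n - 2 * u (n + 1) + u (n + 2)) =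
      u 0 - u N - N * (u N - u (N + 1)) := by
    intro N
    induction N with
    | zero => simp
    | succ N ih =>
      rw [Finset.sum_range_succ, ih]
      push_cast
      ring
  refine summable_of_sum_range_le (c := 1) (fun n => mul_nonneg (by positivity) (hc n)) fun N => ?_
  rw [hsum]
  have := mul_nonneg (Nat.cast_nonneg (α := ℝ) N) (hpos N)
  linarith [h0 N, h1 0]

/-! ### Differences of powers -/

/-- The second derivative is `γ(1-γ)(A - 2cM + c²B)`, where `A`, `M`, `B` are the values of
`t^(γ-2)` at `y-1`, `y`, `y+1`. Log-convexity of that power gives `M² ≤ AB`, so the quadratic in `c`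
is nonnegative. -/
theorem convexOn_combination_neg_rpow {γ : ℝ} (h0 : 0 < γ) (h1 : γ < 1) (c : ℝ) :
    ConvexOn ℝ (Set.Ici 1)
      fun y : ℝ => -(y - 1) ^ γ + 2 * c * y ^ γ - c ^ 2 * (y + 1) ^ γ := by
  refine convexOn_of_hasDerivWithinAt2_nonneg (convex_Ici 1)
    (f' := fun y => -(γ * (y - 1) ^ (γ - 1)) + 2 * c * (γ * y ^ (γ - 1))
      - c ^ 2 * (γ * (y + 1) ^ (γ - 1)))
    (f'' := fun y => -(γ * ((γ - 1) * (y - 1) ^ (γ - 1 - 1)))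
      + 2 * c * (γ * ((γ - 1) * y ^ (γ - 1 - 1)))
      - c ^ 2 * (γ * ((γ - 1) * (y + 1) ^ (γ - 1 - 1)))) ?_ ?_ ?_ ?_
  · have hc : ∀ a : ℝ, Continuous fun y : ℝ => (y + a) ^ γ := fun a =>
      (continuous_add_const a).rpow_const fun x => Or.inr h0.le
    have e1 := hc (-1)
    have e2 := hc 0
    have e3 := hc 1
    simp only [add_zero, ← sub_eq_add_neg] at e1 e2
    exact Continuous.continuousOn (by fun_prop)
  all_goals
    intro y hy
    rw [interior_Ici, Set.mem_Ioi] at hy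
  · have d : ∀ a : ℝ, 0 < y + a → HasDerivAt (fun y : ℝ => (y + a) ^ γ)
        (γ * (y + a) ^ (γ - 1)) y := fun a ha => by
      simpa using ((hasDerivAt_id y).add_const a).rpow_const (p := γ) (Or.inl ha.ne')
    have d1 := d (-1) (by linarith)
    have d2 := d 0 (by linarith)
    have d3 := d 1 (by linarith)
    simp only [add_zero, ← sub_eq_add_neg] at d1 d2
    exact ((d1.neg.add (d2.const_mul (2 * c))).sub (d3.const_mul (c ^ 2))).hasDerivWithinAt
  · have d : ∀ a : ℝ, 0 < y + a → HasDerivAt (fun y : ℝ => γ * (y + a) ^ (γ - 1))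
        (γ * ((γ - 1) * (y + a) ^ (γ - 1 - 1))) y := fun a ha => by
      simpa using (((hasDerivAt_id y).add_const a).rpow_const (p := γ - 1)
        (Or.inl ha.ne')).const_mul γ
    have d1 := d (-1) (by linarith)
    have d2 := d 0 (by linarith)
    have d3 := d 1 (by linarith)
    simp only [add_zero, ← sub_eq_add_neg] at d1 d2
    exact ((d1.neg.add (d2.const_mul (2 * c))).sub (d3.const_mul (c ^ 2))).hasDerivWithinAt
  · set A := (y - 1) ^ (γ - 1 - 1) with hA
    set M := y ^ (γ - 1 - 1) with hM
    set B := (y + 1) ^ (γ - 1 - 1) with hB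
    have hBpos : 0 < B := Real.rpow_pos_of_pos (by linarith) _
    have hMA : M ^ 2 ≤ A * B := by
      rw [hA, hB, hM, sq, ← Real.mul_rpow (by linarith) (by linarith),
        ← Real.mul_rpow (by linarith) (by linarith)]
      refine Real.rpow_le_rpow_of_nonpos (by nlinarith) (by nlinarith) (by linarith)
    have hq : 0 ≤ A - 2 * c * M + c ^ 2 * B := by
      refine nonneg_of_mul_nonneg_right (a := B) ?_ hBpos
      nlinarith [sq_nonneg (c * B - M)]
    have : 0 ≤ γ * (1 - γ) * (A - 2 * c * M + c ^ 2 * B) :=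
      mul_nonneg (mul_nonneg h0.le (by linarith)) hq
    linarith

/-- The negated second difference of `j ↦ j ^ γ`, at `j = n + 1`. -/
noncomputable def negSecondDiff (γ : ℝ) (n : ℕ) : ℝ :=
  2 * ((n : ℝ) + 1) ^ γ - ((n : ℝ) + 2) ^ γ - (n : ℝ) ^ γ

theorem negSecondDiff_pos {γ : ℝ} (h0 : 0 < γ) (h1 : γ < 1) (n : ℕ) :
    0 < negSecondDiff γ n := by
  have h := (Real.strictConcaveOn_rpow h0 h1).2
    (Set.mem_Ici.mpr (by positivity : (0 : ℝ) ≤ n))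
    (Set.mem_Ici.mpr (by positivity : (0 : ℝ) ≤ (n : ℝ) + 2)) (by linarith)
    (by norm_num : (0 : ℝ) < 1 / 2) (by norm_num : (0 : ℝ) < 1 / 2) (by norm_num)
  simp only [smul_eq_mul] at h
  rw [show (1 / 2 * (n : ℝ) + 1 / 2 * ((n : ℝ) + 2)) = n + 1 by ring] at h
  rw [negSecondDiff]
  linarith

/-- Write `d` for `negSecondDiff γ`. The quadratic `d n - 2c d (n+1) + c² d (n+2)` is the second
difference at `n + 2` of the convex function in `convexOn_combination_neg_rpow`, hence nonnegative.
Its minimiser `c = d (n+1) / d (n+2)` yields the claim. -/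
theorem negSecondDiff_logConvex {γ : ℝ} (h0 : 0 < γ) (h1 : γ < 1) (n : ℕ) :
    negSecondDiff γ (n + 1) ^ 2 ≤ negSecondDiff γ n * negSecondDiff γ (n + 2) := by
  set c := negSecondDiff γ (n + 1) / negSecondDiff γ (n + 2) with hc
  have h2 := negSecondDiff_pos h0 h1 (n + 2)
  have h := (convexOn_combination_neg_rpow h0 h1 c).2
    (Set.mem_Ici.mpr (by linarith [(Nat.cast_nonneg n : (0 : ℝ) ≤ n)] : 1 ≤ (n : ℝ) + 1))
    (Set.mem_Ici.mpr (by linarith [(Nat.cast_nonneg n : (0 : ℝ) ≤ n)] : 1 ≤ (n : ℝ) + 3))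
    (by norm_num : (0 : ℝ) ≤ 1 / 2) (by norm_num : (0 : ℝ) ≤ 1 / 2) (by norm_num)
  simp only [smul_eq_mul] at h
  rw [show (1 / 2 * ((n : ℝ) + 1) + 1 / 2 * ((n : ℝ) + 3)) = n + 2 by ring] at h
  have key : 0 ≤ negSecondDiff γ n - 2 * c * negSecondDiff γ (n + 1)
      + c ^ 2 * negSecondDiff γ (n + 2) := by
    simp only [negSecondDiff]
    push_cast
    ring_nf at h ⊢
    linarith
  have hc' : c * negSecondDiff γ (n + 2) = negSecondDiff γ (n + 1) := by
    rw [hc, div_mul_cancel₀ _ h2.ne']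
  have := mul_nonneg key h2.le
  nlinarith

theorem sum_negSecondDiff_le {γ : ℝ} (h0 : 0 < γ) (N : ℕ) :
    ∑ k ∈ Finset.range N, negSecondDiff γ k ≤ 1 := by
  have h : ∑ k ∈ Finset.range N, negSecondDiff γ k = 1 - (((N : ℝ) + 1) ^ γ - (N : ℝ) ^ γ) := by
    induction N with
    | zero => simp [h0.ne']
    | succ N ih =>
      rw [Finset.sum_range_succ, ih, negSecondDiff]
      push_cast
      ring_nf
  rw [h]
  have : (N : ℝ) ^ γ ≤ ((N : ℝ) + 1) ^ γ :=
    Real.rpow_le_rpow (by positivity) (by linarith) h0.le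
  linarith

/-! ### Summability of the weights -/

theorem mk_schemeWeight_mul (α : ℝ) :
    PowerSeries.mk (schemeWeight α) * PowerSeries.mk (fun j : ℕ => ((j : ℝ) + 1) ^ (α - 1)) =
      PowerSeries.C (Real.Gamma α) := by
  ext m
  rw [PowerSeries.coeff_mul, PowerSeries.coeff_C, ← schemeWeight_system,
    Finset.Nat.sum_antidiagonal_eq_sum_range_succ_mk]
  refine Finset.sum_congr rfl fun i hi => ?_
  have hi' : i ≤ m := by simpa [Nat.lt_succ_iff] using hi
  simp only [PowerSeries.coeff_mk]
  rw [show m + 1 - i = m - i + 1 by omega]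
  push_cast
  rfl

theorem coeff_one_sub_X_sq_mul (F : PowerSeries ℝ) (n : ℕ) :
    PowerSeries.coeff (n + 2) ((1 - PowerSeries.X) ^ 2 * F) =
      PowerSeries.coeff n F - 2 * PowerSeries.coeff (n + 1) F + PowerSeries.coeff (n + 2) F := by
  have : (1 - PowerSeries.X) ^ 2 * F =
      F - 2 * (PowerSeries.X * F) + PowerSeries.X * (PowerSeries.X * F) := by ring
  rw [this, two_mul]
  simp only [map_add, map_sub, PowerSeries.coeff_succ_X_mul]
  ring

theorem one_sub_X_sq_mul_mk_rpow {γ : ℝ} (hγ : γ ≠ 0) :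
    (1 - PowerSeries.X) ^ 2 * PowerSeries.mk (fun j : ℕ => ((j : ℝ) + 1) ^ γ) =
      1 - PowerSeries.X * PowerSeries.mk (negSecondDiff γ) := by
  ext n
  match n with
  | 0 => simp
  | 1 =>
    have : (1 - PowerSeries.X) ^ 2 * PowerSeries.mk (fun j : ℕ => ((j : ℝ) + 1) ^ γ) =
        PowerSeries.mk (fun j : ℕ => ((j : ℝ) + 1) ^ γ) -
          PowerSeries.X * (PowerSeries.mk (fun j : ℕ => ((j : ℝ) + 1) ^ γ) +
            (PowerSeries.mk (fun j : ℕ => ((j : ℝ) + 1) ^ γ) -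
              PowerSeries.X * PowerSeries.mk (fun j : ℕ => ((j : ℝ) + 1) ^ γ))) := by ring
    rw [this]
    change PowerSeries.coeff (0 + 1) _ = PowerSeries.coeff (0 + 1) _
    simp only [map_sub, PowerSeries.coeff_succ_X_mul, PowerSeries.coeff_mk,
      map_add, PowerSeries.coeff_zero_X_mul, PowerSeries.coeff_one]
    -- The coefficient of `z` is `2^γ - 2`, which equals `-negSecondDiff γ 0` because `0^γ = 0`;
    -- this is where `γ ≠ 0` enters.
    simp [negSecondDiff, Real.zero_rpow hγ]
    norm_num
  | n + 2 =>
    rw [coeff_one_sub_X_sq_mul]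
    simp only [map_sub, PowerSeries.coeff_mk, show n + 2 = (n + 1) + 1 from rfl,
      PowerSeries.coeff_succ_X_mul, PowerSeries.coeff_one, negSecondDiff]
    push_cast
    norm_num
    ring_nf

/-- The coefficients of `1 / (1 - z Q(z))`, where `Q` is the generating function of `q`. -/
noncomputable def renewalSeq (q : ℕ → ℝ) (n : ℕ) : ℝ :=
  PowerSeries.coeff n (1 - PowerSeries.X * PowerSeries.mk q)⁻¹

theorem mk_renewalSeq_mul (q : ℕ → ℝ) :
    PowerSeries.mk (renewalSeq q) * (1 - PowerSeries.X * PowerSeries.mk q) = 1 := by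
  have : PowerSeries.mk (renewalSeq q) = (1 - PowerSeries.X * PowerSeries.mk q)⁻¹ := by
    ext n
    simp [renewalSeq]
  rw [this]
  exact PowerSeries.inv_mul_cancel (1 - PowerSeries.X * PowerSeries.mk q) (by simp)

theorem renewalSeq_zero (q : ℕ → ℝ) : renewalSeq q 0 = 1 := by
  simp [renewalSeq]

theorem renewalSeq_succ (q : ℕ → ℝ) (n : ℕ) :
    renewalSeq q (n + 1) = ∑ k ∈ Finset.range (n + 1), q (n - k) * renewalSeq q k := by
  have h : PowerSeries.mk (renewalSeq q) =
      1 + PowerSeries.X * (PowerSeries.mk (renewalSeq q) * PowerSeries.mk q) := by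
    linear_combination mk_renewalSeq_mul q
  have h1 := congrArg (PowerSeries.coeff (n + 1)) h
  rw [map_add, PowerSeries.coeff_succ_X_mul, PowerSeries.coeff_mul, PowerSeries.coeff_mk,
    Finset.Nat.sum_antidiagonal_eq_sum_range_succ_mk] at h1
  rw [h1]
  simp [PowerSeries.coeff_one, mul_comm]

/-- Dividing `Γ(α)` by `∑ (j+1)^(α-1) z^j = (1 - zQ)/(1-z)²` gives `W = Γ(α)(1-z)² U`, with `U` the
renewal series. -/
theorem schemeWeight_add_two {α : ℝ} (hα : 1 < α) (n : ℕ) :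
    schemeWeight α (n + 2) = Real.Gamma α * (renewalSeq (negSecondDiff (α - 1)) n
      - 2 * renewalSeq (negSecondDiff (α - 1)) (n + 1)
      + renewalSeq (negSecondDiff (α - 1)) (n + 2)) := by
  have hA := one_sub_X_sq_mul_mk_rpow (γ := α - 1) (by linarith)
  have hU := mk_renewalSeq_mul (negSecondDiff (α - 1))
  have hW := mk_schemeWeight_mul α
  rw [← hA] at hU
  have h : PowerSeries.mk (schemeWeight α) = PowerSeries.C (Real.Gamma α) *
      ((1 - PowerSeries.X) ^ 2 * PowerSeries.mk (renewalSeq (negSecondDiff (α - 1)))) := by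
    linear_combination (PowerSeries.mk (renewalSeq (negSecondDiff (α - 1)))
      * (1 - PowerSeries.X) ^ 2) * hW - PowerSeries.mk (schemeWeight α) * hU
  have h1 := congrArg (PowerSeries.coeff (n + 2)) h
  rw [PowerSeries.coeff_C_mul, coeff_one_sub_X_sq_mul] at h1
  simpa using h1

theorem renewalSeq_nonneg {q : ℕ → ℝ} (hq : ∀ n, 0 ≤ q n) (n : ℕ) : 0 ≤ renewalSeq q n := by
  induction n using Nat.strong_induction_on with
  | _ n ih =>
  cases n with
  | zero => simp [renewalSeq_zero]
  | succ n =>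
    rw [renewalSeq_succ]
    refine Finset.sum_nonneg fun k hk => mul_nonneg (hq _) (ih k ?_)
    simpa using hk

theorem renewalSeq_pos {q : ℕ → ℝ} (hq : ∀ n, 0 < q n) (n : ℕ) : 0 < renewalSeq q n := by
  cases n with
  | zero => simp [renewalSeq_zero]
  | succ n =>
    rw [renewalSeq_succ, Finset.sum_range_succ']
    have : 0 < q (n - 0) * renewalSeq q 0 := by
      rw [renewalSeq_zero, mul_one]
      exact hq _
    have h2 : 0 ≤ ∑ k ∈ Finset.range n, q (n - (k + 1)) * renewalSeq q (k + 1) :=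
      Finset.sum_nonneg fun k _ =>
        mul_nonneg (hq _).le (renewalSeq_nonneg (fun n => (hq n).le) _)
    linarith

theorem renewalSeq_le_one {q : ℕ → ℝ} (hq : ∀ n, 0 ≤ q n)
    (hs : ∀ N, ∑ k ∈ Finset.range N, q k ≤ 1) (n : ℕ) : renewalSeq q n ≤ 1 := by
  induction n using Nat.strong_induction_on with
  | _ n ih =>
  cases n with
  | zero => simp [renewalSeq_zero]
  | succ n =>
    rw [renewalSeq_succ]
    calc ∑ k ∈ Finset.range (n + 1), q (n - k) * renewalSeq q k
        ≤ ∑ k ∈ Finset.range (n + 1), q (n + 1 - 1 - k) := by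
          refine Finset.sum_le_sum fun k hk => ?_
          exact mul_le_of_le_one_right (hq _) (ih k (by simpa using hk))
      _ ≤ 1 := by rw [Finset.sum_range_reflect]; exact hs _

/-- The weights are absolutely summable, even against `n`. -/
theorem summable_mul_abs_schemeWeight {α : ℝ} (h1 : 1 < α) (h2 : α ≤ 2) :
    Summable fun n : ℕ => ((n : ℝ) + 1) * |schemeWeight α n| := by
  set q := negSecondDiff (α - 1) with hq
  have hq0 : ∀ n, 0 ≤ q n := by
    intro n
    rcases h2.lt_or_eq with h | rfl
    · exact (negSecondDiff_pos (by linarith) (by linarith) n).le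
    · rw [hq, negSecondDiff]
      norm_num
      linarith
  have hconv : ∀ n, 0 ≤ renewalSeq q n - 2 * renewalSeq q (n + 1) + renewalSeq q (n + 2) := by
    rcases h2.lt_or_eq with h | h
    · have hqp : ∀ n, 0 < q n := negSecondDiff_pos (by linarith) (by linarith)
      refine convex_of_logConvex (renewalSeq_pos hqp) (renewal_logConvex hqp
        (negSecondDiff_logConvex (by linarith) (by linarith)) (renewalSeq_pos hqp)
        (renewalSeq_zero q) (renewalSeq_succ q))
    -- For `α = 2` the power is linear and `q` vanishes, so the renewal sequence is `1, 0, 0, …`;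
    -- log-convexity with strict positivity is unavailable.
    · have hqz : ∀ n, q n = 0 := fun n => by
        rw [hq, negSecondDiff, h]
        norm_num
        ring
      have hz : ∀ n, renewalSeq q (n + 1) = 0 := fun n => by
        rw [renewalSeq_succ]
        simp [hqz]
      intro n
      rw [hz, hz]
      simpa using renewalSeq_nonneg hq0 n
  have hs := summable_mul_second_difference (renewalSeq_nonneg hq0)
    (renewalSeq_le_one hq0 (sum_negSecondDiff_le (by linarith))) hconv
  rw [← summable_nat_add_iff 2]
  -- After the shift by two the weight is `n + 3`, and `n + 3 ≤ 3(n + 1)`.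
  refine Summable.of_nonneg_of_le (fun n => by positivity) (fun n => ?_)
    (hs.mul_left (3 * Real.Gamma α))
  have hΓ : 0 < Real.Gamma α := Real.Gamma_pos_of_pos (by linarith)
  rw [schemeWeight_add_two h1, abs_mul, abs_of_pos hΓ, abs_of_nonneg (hconv n)]
  have hn : (0 : ℝ) ≤ n := Nat.cast_nonneg n
  have := mul_nonneg hΓ.le (hconv n)
  push_cast
  rw [show 3 * Real.Gamma α * (((n : ℝ) + 1) * (renewalSeq q n - 2 * renewalSeq q (n + 1)
    + renewalSeq q (n + 2))) = (3 * ((n : ℝ) + 1)) * (Real.Gamma α * (renewalSeq q n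
    - 2 * renewalSeq q (n + 1) + renewalSeq q (n + 2))) by ring]
  exact mul_le_mul_of_nonneg_right (by linarith) this

theorem summable_abs_schemeWeight {α : ℝ} (h1 : 1 < α) (h2 : α ≤ 2) :
    Summable fun n : ℕ => |schemeWeight α n| := by
  refine Summable.of_nonneg_of_le (fun n => abs_nonneg _) (fun n => ?_)
    (summable_mul_abs_schemeWeight h1 h2)
  exact le_mul_of_one_le_left (abs_nonneg _) (by linarith [(Nat.cast_nonneg n : (0 : ℝ) ≤ n)])

/-! ### The Laplace transform of a power -/

theorem integrableOn_rpow_mul_exp_neg {a σ : ℝ} (ha : 0 < a) (hσ : 0 < σ) :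
    IntegrableOn (fun t : ℝ => t ^ (a - 1) * Real.exp (-(σ * t))) (Set.Ioi 0) := by
  have h := integrableOn_rpow_mul_exp_neg_mul_rpow (p := 1) (s := a - 1) (b := σ)
    (by linarith) (by norm_num) hσ
  simpa only [Real.rpow_one, neg_mul] using h

/-- The measure with density `t ^ (a - 1)` on the positive half-line. -/
noncomputable def powerMeasure (a : ℝ) : Measure ℝ :=
  (volume.restrict (Set.Ioi 0)).withDensity fun t => ENNReal.ofReal (t ^ (a - 1))

theorem integral_powerMeasure {E : Type*} [NormedAddCommGroup E] [NormedSpace ℝ E]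
    (a : ℝ) (g : ℝ → E) :
    ∫ t, g t ∂(powerMeasure a) = ∫ t in Set.Ioi 0, t ^ (a - 1) • g t := by
  rw [powerMeasure, integral_withDensity_eq_integral_toReal_smul (by fun_prop)
    (ae_of_all _ fun t => ENNReal.ofReal_lt_top)]
  refine setIntegral_congr_fun measurableSet_Ioi fun t ht => ?_
  rw [ENNReal.toReal_ofReal (Real.rpow_nonneg (le_of_lt ht) _)]

theorem Iio_subset_integrableExpSet_powerMeasure {a : ℝ} (ha : 0 < a) :
    Set.Iio 0 ⊆ ProbabilityTheory.integrableExpSet id (powerMeasure a) := by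
  intro t ht
  change Integrable _ _
  rw [powerMeasure, integrable_withDensity_iff_integrable_smul' (by fun_prop)
    (ae_of_all _ fun t => ENNReal.ofReal_lt_top)]
  refine (integrableOn_rpow_mul_exp_neg ha (neg_pos.mpr ht)).congr_fun (fun x hx => ?_)
    measurableSet_Ioi
  simp only [smul_eq_mul, id]
  rw [ENNReal.toReal_ofReal (Real.rpow_nonneg (le_of_lt hx) _)]
  simp

/-- Analytic continuation from real `r`: the integral is the complex moment generating function of
`powerMeasure a` at `-r`, and both sides are analytic on a connected half-plane. -/
theorem integral_rpow_mul_cexp_neg_mul_Ioi {a : ℝ} (ha : 0 < a) {r : ℂ} (hr : 0 < r.re) :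
    ∫ t : ℝ in Set.Ioi 0, ((t ^ (a - 1) : ℝ) : ℂ) * Complex.exp (-(r * t)) =
      r ^ (-a : ℂ) * Real.Gamma a := by
  have hopen : IsOpen {z : ℂ | z.re < 0} := isOpen_lt Complex.continuous_re continuous_const
  have hX : AnalyticOnNhd ℂ (ProbabilityTheory.complexMGF id (powerMeasure a))
      {z : ℂ | z.re < 0} := by
    refine ProbabilityTheory.analyticOnNhd_complexMGF.mono fun z hz => ?_
    exact interior_mono (Iio_subset_integrableExpSet_powerMeasure ha)
      (by rw [interior_Iio]; exact hz)
  have hY : AnalyticOnNhd ℂ (fun z : ℂ => (-z) ^ (-a : ℂ) * Real.Gamma a)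
      {z : ℂ | z.re < 0} := by
    refine DifferentiableOn.analyticOnNhd (fun z hz => ?_) hopen
    refine DifferentiableAt.differentiableWithinAt ?_
    refine DifferentiableAt.mul_const ?_ _
    exact differentiableAt_id.neg.cpow_const (Or.inl (by simpa using hz))
  have heq : Set.EqOn (ProbabilityTheory.complexMGF id (powerMeasure a))
      (fun z : ℂ => (-z) ^ (-a : ℂ) * Real.Gamma a) {z : ℂ | z.re < 0} := by
    refine AnalyticOnNhd.eqOn_of_preconnected_of_frequently_eq hX hY
      ((convex_halfSpace_re_lt 0).isPreconnected) (z₀ := ((-1 : ℝ) : ℂ)) (by simp) ?_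
    have h_real : ∃ᶠ (x : ℝ) in 𝓝[≠] (-1), ProbabilityTheory.complexMGF id (powerMeasure a) x =
        (-(x : ℂ)) ^ (-a : ℂ) * Real.Gamma a := by
      refine Eventually.frequently ?_
      have hev : ∀ᶠ x : ℝ in 𝓝[≠] (-1), x < 0 :=
        nhdsWithin_le_nhds (Iio_mem_nhds (by norm_num))
      filter_upwards [hev] with x hx
      rw [ProbabilityTheory.complexMGF_ofReal, ProbabilityTheory.mgf, integral_powerMeasure]
      have h := Real.integral_rpow_mul_exp_neg_mul_Ioi ha (neg_pos.mpr hx)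
      have h2 : ∫ t in Set.Ioi 0, t ^ (a - 1) • Real.exp (x * id t) =
          (1 / -x) ^ a * Real.Gamma a := by
        rw [← h]
        simp
      rw [h2, Complex.ofReal_mul, ← Complex.ofReal_neg, ← Complex.ofReal_neg,
        ← Complex.ofReal_cpow (by linarith), one_div, Real.inv_rpow (by linarith),
        Real.rpow_neg (by linarith)]
    rw [frequently_iff_seq_forall] at h_real ⊢
    obtain ⟨xs, hx_tendsto, hx_eq⟩ := h_real
    refine ⟨fun n => xs n, ?_, fun n => hx_eq n⟩
    rw [tendsto_nhdsWithin_iff] at hx_tendsto ⊢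
    constructor
    · rw [tendsto_ofReal_iff]
      exact hx_tendsto.1
    · filter_upwards [hx_tendsto.2] with n hn h0
      exact hn (Complex.ofReal_injective h0)
  have := heq (x := -r) (by simpa using hr)
  simp only [neg_neg] at this
  rw [← this, ProbabilityTheory.complexMGF, integral_powerMeasure]
  simp

/-- The power `x_+^(a-1)` with exponential damping. -/
noncomputable def dampedPower (a : ℝ) (s : ℂ) (x : ℝ) : ℂ :=
  Set.indicator (Set.Ioi 0) (fun t : ℝ => ((t ^ (a - 1) : ℝ) : ℂ) * Complex.exp (-(s * t))) x

theorem integrable_dampedPower {a : ℝ} (ha : 0 < a) {s : ℂ} (hs : 0 < s.re) :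
    Integrable (dampedPower a s) := by
  refine (integrable_indicator_iff measurableSet_Ioi).mpr ?_
  refine (integrableOn_rpow_mul_exp_neg ha hs).mono' ?_ ?_
  · refine AEStronglyMeasurable.mul ?_ (by fun_prop)
    exact (by fun_prop : Measurable fun t : ℝ => ((t ^ (a - 1) : ℝ) : ℂ)).aestronglyMeasurable
  · refine (ae_restrict_iff' measurableSet_Ioi).mpr (ae_of_all _ fun t ht => ?_)
    rw [norm_mul, Complex.norm_real, Real.norm_of_nonneg (Real.rpow_nonneg (le_of_lt ht) _),
      Complex.norm_exp]
    simp

theorem fourierHat_dampedPower {a : ℝ} (ha : 0 < a) {s : ℂ} (hs : 0 < s.re) (k : ℝ) :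
    fourierHat (dampedPower a s) k = (s + Complex.I * k) ^ (-a : ℂ) * Real.Gamma a := by
  rw [← integral_rpow_mul_cexp_neg_mul_Ioi ha (by simpa using hs), fourierHat,
    ← integral_indicator measurableSet_Ioi]
  congr 1 with x
  rw [dampedPower]
  by_cases hx : x ∈ Set.Ioi (0 : ℝ)
  · rw [Set.indicator_of_mem hx, Set.indicator_of_mem hx, mul_left_comm, ← Complex.exp_add]
    congr 2
    ring
  · rw [Set.indicator_of_notMem hx, Set.indicator_of_notMem hx, mul_zero]

theorem dampedPower_eq {a : ℝ} (ha : 1 < a) (s : ℂ) (x : ℝ) :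
    dampedPower a s x = (((max x 0) ^ (a - 1) : ℝ) : ℂ) * Complex.exp (-(s * x)) := by
  rw [dampedPower]
  by_cases hx : x ∈ Set.Ioi (0 : ℝ)
  · rw [Set.indicator_of_mem hx, max_eq_left (le_of_lt hx)]
  · rw [Set.indicator_of_notMem hx, max_eq_right (not_lt.mp hx),
      Real.zero_rpow (by linarith)]
    simp

theorem continuous_dampedPower {a : ℝ} (ha : 1 < a) (s : ℂ) : Continuous (dampedPower a s) := by
  rw [funext (dampedPower_eq ha s)]
  have : Continuous fun x : ℝ => (max x 0) ^ (a - 1) :=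
    (continuous_id.max continuous_const).rpow_const fun x => Or.inr (by linarith)
  fun_prop

theorem dampedPower_isBigO {a : ℝ} {s : ℂ} (hs : 0 < s.re) (b : ℝ) :
    dampedPower a s =O[cocompact ℝ] fun x : ℝ => |x| ^ (-b) := by
  rw [cocompact_eq_atBot_atTop, Asymptotics.isBigO_sup]
  constructor
  · refine Asymptotics.IsBigO.of_bound 0 ?_
    filter_upwards [eventually_le_atBot 0] with x hx
    rw [dampedPower, Set.indicator_of_notMem (by simpa using hx)]
    simp
  · have h := (isLittleO_exp_neg_mul_rpow_atTop hs (-b - (a - 1))).isBigO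
    have h2 := (Asymptotics.isBigO_refl (fun x : ℝ => x ^ (a - 1)) atTop).mul h
    refine (Asymptotics.IsBigO.congr' (f₁ := fun x : ℝ => x ^ (a - 1) * Real.exp (-s.re * x))
      (g₁ := fun x : ℝ => x ^ (a - 1) * x ^ (-b - (a - 1))) (f₂ := fun x => ‖dampedPower a s x‖)
      h2 ?_ ?_).of_norm_left
    · filter_upwards [eventually_gt_atTop 0] with x hx
      rw [dampedPower, Set.indicator_of_mem (Set.mem_Ioi.mpr hx), norm_mul, Complex.norm_real,
        Real.norm_of_nonneg (Real.rpow_nonneg (le_of_lt hx) _), Complex.norm_exp]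
      simp
    · filter_upwards [eventually_gt_atTop 0] with x hx
      rw [← Real.rpow_add hx, abs_of_pos hx]
      ring_nf

/-! ### The Lipschitz summation formula -/

/-- The shifted point `s + 2πin`. -/
noncomputable def latticePoint (s : ℂ) (n : ℤ) : ℂ := s + 2 * Real.pi * Complex.I * n

theorem latticePoint_im (s : ℂ) (n : ℤ) : (latticePoint s n).im = s.im + 2 * Real.pi * n := by
  simp [latticePoint]

/-- Since `π > 3`, `2π|n| - 3 ≥ |n|` for `n ≠ 0`. The strip `|Im s| ≤ 3` thus keeps these lattice
points off the branch cut and bounds their powers uniformly. -/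
theorem abs_le_abs_latticePoint_im {s : ℂ} (hs : |s.im| ≤ 3) {n : ℤ} (hn : n ≠ 0) :
    |(n : ℝ)| ≤ |(latticePoint s n).im| := by
  have h1 : (1 : ℝ) ≤ |(n : ℝ)| := by exact_mod_cast Int.one_le_abs hn
  rw [latticePoint_im]
  have h2 : |2 * Real.pi * n| - |s.im| ≤ |s.im + 2 * Real.pi * n| := by
    have := abs_sub_abs_le_abs_sub (2 * Real.pi * n) (-s.im)
    rwa [abs_neg, sub_neg_eq_add, add_comm] at this
  rw [abs_mul, abs_of_pos (by positivity : (0 : ℝ) < 2 * Real.pi)] at h2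
  have := Real.pi_gt_three
  nlinarith

theorem norm_latticePoint_cpow_le {s : ℂ} (hs : |s.im| ≤ 3) {n : ℤ} (hn : n ≠ 0) {b : ℝ}
    (hb : 0 ≤ b) : ‖latticePoint s n ^ (-b : ℂ)‖ ≤ |(n : ℝ)| ^ (-b) := by
  have h0 : 0 < |(n : ℝ)| := abs_pos.mpr (by exact_mod_cast hn)
  have := Complex.norm_cpow_real (latticePoint s n) (-b)
  rw [Complex.ofReal_neg] at this
  rw [this]
  refine Real.rpow_le_rpow_of_nonpos h0 ?_ (by linarith)
  exact (abs_le_abs_latticePoint_im hs hn).trans (Complex.abs_im_le_norm _)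

theorem latticePoint_mem_slitPlane {s : ℂ} (hs : |s.im| ≤ 3) {n : ℤ} (hn : n ≠ 0) :
    latticePoint s n ∈ Complex.slitPlane := by
  refine Or.inr fun h => ?_
  have := abs_le_abs_latticePoint_im hs hn
  rw [h, abs_zero] at this
  exact hn (by exact_mod_cast abs_eq_zero.mp (le_antisymm this (abs_nonneg _)))

/-- `∑_{n ≠ 0} (s + 2πin)^(-b)`. -/
noncomputable def puncturedLatticeSum (b : ℝ) (s : ℂ) : ℂ :=
  ∑' n : ℤ, if n = 0 then 0 else latticePoint s n ^ (-b : ℂ)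

theorem norm_puncturedLattice_term_le {s : ℂ} (hs : |s.im| ≤ 3) (n : ℤ) {b : ℝ} (hb : 0 < b) :
    ‖if n = 0 then 0 else latticePoint s n ^ (-b : ℂ)‖ ≤ |(n : ℝ)| ^ (-b) := by
  split_ifs with hn
  · rw [norm_zero]; positivity
  · exact norm_latticePoint_cpow_le hs hn hb.le

theorem norm_puncturedLatticeSum_le {s : ℂ} (hs : |s.im| ≤ 3) {b : ℝ} (hb : 1 < b) :
    ‖puncturedLatticeSum b s‖ ≤ ∑' n : ℤ, |(n : ℝ)| ^ (-b) :=
  tsum_of_norm_bounded (Real.summable_abs_int_rpow hb).hasSum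
    fun n => norm_puncturedLattice_term_le hs n (by linarith)

/-- **Lipschitz summation formula**, from Poisson summation. -/
theorem tsum_rpow_mul_cexp_neg {a : ℝ} (ha : 1 < a) {s : ℂ} (hs : 0 < s.re) (hs' : |s.im| ≤ 3) :
    ∑' j : ℕ, ((((j : ℝ) + 1) ^ (a - 1) : ℝ) : ℂ) * Complex.exp (-(s * (j + 1))) =
      Real.Gamma a * (s ^ (-a : ℂ) + puncturedLatticeSum a s) := by
  have hF : ∀ n : ℤ, 𝓕 (dampedPower a s) n = latticePoint s n ^ (-a : ℂ) * Real.Gamma a := by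
    intro n
    rw [fourier_eq_fourierHat, fourierHat_dampedPower (by linarith) hs, latticePoint]
    congr 2
    push_cast
    ring
  have hsum : Summable fun n : ℤ => |(n : ℝ)| ^ (-a) := Real.summable_abs_int_rpow ha
  have hterm : Summable fun n : ℤ => latticePoint s n ^ (-a : ℂ) := by
    refine hsum.of_norm_bounded_eventually ?_
    rw [Filter.eventually_cofinite]
    refine (Set.finite_singleton (0 : ℤ)).subset fun n hn => ?_
    by_contra h
    exact hn (norm_latticePoint_cpow_le hs' h (by linarith))
  -- Poisson summation at the point `0`. The damped power is continuous at the origin because `a >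
  -- 1`.
  have hP := Real.tsum_eq_tsum_fourier_of_rpow_decay_of_summable (continuous_dampedPower ha s) ha
    (dampedPower_isBigO hs a) (by simpa only [hF] using hterm.mul_right _) 0
  simp only [zero_add, QuotientAddGroup.mk_zero, fourier_eval_zero, mul_one, hF] at hP
  rw [tsum_mul_right, hterm.tsum_eq_add_tsum_ite 0] at hP
  have h0 : latticePoint s 0 = s := by simp [latticePoint]
  rw [h0] at hP
  rw [puncturedLatticeSum, mul_comm, ← hP]
  have hinj : Function.Injective fun j : ℕ => ((j : ℤ) + 1) := fun i j h => by
    have : (i : ℤ) + 1 = j + 1 := h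
    omega
  -- The samples at `n ≤ 0` vanish, so the sum over the integers reduces to `n = j + 1`.
  rw [← hinj.tsum_eq (f := fun n : ℤ => dampedPower a s n)]
  · refine tsum_congr fun j => ?_
    have hj : ((((j : ℤ) + 1 : ℤ) : ℝ)) ∈ Set.Ioi (0 : ℝ) := by
      push_cast
      exact Set.mem_Ioi.mpr (by positivity)
    rw [dampedPower, Set.indicator_of_mem hj]
    push_cast
    rfl
  · intro n hn
    have hn' : (n : ℝ) ∈ Set.Ioi (0 : ℝ) := Set.mem_of_indicator_ne_zero hn
    have : 0 < n := by exact_mod_cast Set.mem_Ioi.mp hn'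
    exact ⟨(n - 1).toNat, by simp; omega⟩

/-! ### The symbol of the difference scheme -/

/-- The generating function of the weights. -/
noncomputable def weightSeries (α : ℝ) (z : ℂ) : ℂ := ∑' m : ℕ, (schemeWeight α m : ℂ) * z ^ m

theorem norm_weight_term_le (α : ℝ) {z : ℂ} (hz : ‖z‖ ≤ 1) (m : ℕ) :
    ‖(schemeWeight α m : ℂ) * z ^ m‖ ≤ |schemeWeight α m| := by
  rw [norm_mul, Complex.norm_real, norm_pow, Real.norm_eq_abs]
  exact mul_le_of_le_one_right (abs_nonneg _) (pow_le_one₀ (norm_nonneg _) hz)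

theorem weightSeries_mul {α : ℝ} (h1 : 1 < α) (h2 : α ≤ 2) {z : ℂ} (hz : ‖z‖ ≤ 1)
    (hs : Summable fun j : ℕ => ‖((((j : ℝ) + 1) ^ (α - 1) : ℝ) : ℂ) * z ^ j‖) :
    weightSeries α z * ∑' j : ℕ, ((((j : ℝ) + 1) ^ (α - 1) : ℝ) : ℂ) * z ^ j = Real.Gamma α := by
  rw [weightSeries, tsum_mul_tsum_eq_tsum_sum_antidiagonal_of_summable_norm
    (Summable.of_nonneg_of_le (fun _ => norm_nonneg _) (norm_weight_term_le α hz)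
      (summable_abs_schemeWeight h1 h2)) hs]
  rw [tsum_eq_single 0]
  · simp [schemeWeight]
  · intro m hm
    have h := schemeWeight_system α m
    rw [if_neg hm] at h
    rw [Finset.Nat.sum_antidiagonal_eq_sum_range_succ_mk]
    have h3 : ∑ i ∈ Finset.range (m + 1), (schemeWeight α i : ℂ) * z ^ i *
        (((((m - i : ℕ) : ℝ) + 1) ^ (α - 1) : ℝ) * z ^ (m - i)) =
        ((∑ i ∈ Finset.range (m + 1),
          schemeWeight α i * ((m + 1 - i : ℕ) : ℝ) ^ (α - 1) : ℝ) : ℂ) * z ^ m := by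
      rw [Complex.ofReal_sum, Finset.sum_mul]
      refine Finset.sum_congr rfl fun i hi => ?_
      have hi' : i ≤ m := by simpa [Nat.lt_succ_iff] using hi
      rw [show m + 1 - i = m - i + 1 by omega]
      have : z ^ m = z ^ i * z ^ (m - i) := by rw [← pow_add]; congr 1; omega
      rw [this]
      push_cast
      ring
    rw [Nat.succ_eq_add_one, h3, h]
    simp

/-- Lipschitz's formula evaluates the second factor of `weightSeries_mul` at `z = e^(-s)`. The extra
`e^s` matches `e^(-s(j+1))` with `z^j`, and reflects the scheme starting at `n = -1`. -/
theorem weightSeries_mul_lattice_of_re_pos {α : ℝ} (h1 : 1 < α) (h2 : α ≤ 2) {s : ℂ}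
    (hs : 0 < s.re) (hs' : |s.im| ≤ 3) :
    weightSeries α (Complex.exp (-s)) * Complex.exp s *
      (s ^ (-α : ℂ) + puncturedLatticeSum α s) = 1 := by
  have hz : ‖Complex.exp (-s)‖ < 1 := by
    rw [Complex.norm_exp]
    simpa using hs
  have hexp : ∀ j : ℕ, Complex.exp (-(s * (j + 1))) =
      Complex.exp (-s) * Complex.exp (-s) ^ j := fun j => by
    rw [← Complex.exp_nat_mul, ← Complex.exp_add]
    congr 1
    ring
  have hsum : Summable fun j : ℕ =>
      ‖((((j : ℝ) + 1) ^ (α - 1) : ℝ) : ℂ) * Complex.exp (-s) ^ j‖ := by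
    have hg := summable_norm_pow_mul_geometric_of_norm_lt_one (R := ℂ) 1 hz
    have hg0 := (summable_norm_pow_mul_geometric_of_norm_lt_one (R := ℂ) 0 hz)
    refine Summable.of_nonneg_of_le (fun _ => norm_nonneg _) (fun j => ?_) (hg.add hg0)
    have hj : (1 : ℝ) ≤ (j : ℝ) + 1 := by linarith [(Nat.cast_nonneg j : (0 : ℝ) ≤ j)]
    rw [norm_mul, Complex.norm_real, Real.norm_of_nonneg (by positivity)]
    simp only [norm_mul, pow_one, pow_zero, Complex.norm_natCast, one_mul]
    have h3 : ((j : ℝ) + 1) ^ (α - 1) ≤ (j : ℝ) + 1 := by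
      calc ((j : ℝ) + 1) ^ (α - 1) ≤ ((j : ℝ) + 1) ^ (1 : ℝ) :=
            Real.rpow_le_rpow_of_exponent_le hj (by linarith)
        _ = _ := Real.rpow_one _
    calc _ ≤ ((j : ℝ) + 1) * ‖Complex.exp (-s) ^ j‖ :=
          mul_le_mul_of_nonneg_right h3 (norm_nonneg _)
      _ = _ := by ring
  have hW := weightSeries_mul h1 h2 hz.le hsum
  have hL := tsum_rpow_mul_cexp_neg h1 hs hs'
  simp only [hexp, mul_left_comm _ (Complex.exp (-s))] at hL
  rw [tsum_mul_left] at hL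
  have hΓ : (Real.Gamma α : ℂ) ≠ 0 := by
    exact_mod_cast (Real.Gamma_pos_of_pos (by linarith)).ne'
  have hee : Complex.exp s * Complex.exp (-s) = 1 := by
    rw [← Complex.exp_add, add_neg_cancel, Complex.exp_zero]
  apply mul_left_cancel₀ hΓ
  calc _ = weightSeries α (Complex.exp (-s)) * Complex.exp s * (Real.Gamma α *
        (s ^ (-α : ℂ) + puncturedLatticeSum α s)) := by ring
    _ = _ := by
        rw [← hL, mul_one, ← hW]
        linear_combination (weightSeries α (Complex.exp (-s)) *
          ∑' j : ℕ, ((((j : ℝ) + 1) ^ (α - 1) : ℝ) : ℂ) * Complex.exp (-s) ^ j) * hee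

theorem I_mul_ofReal_mem_slitPlane {k : ℝ} (hk : k ≠ 0) : Complex.I * k ∈ Complex.slitPlane :=
  Or.inr (by simpa using hk)

theorem I_mul_ofReal_ne_zero {k : ℝ} (hk : k ≠ 0) : Complex.I * (k : ℂ) ≠ 0 :=
  Complex.slitPlane_ne_zero (I_mul_ofReal_mem_slitPlane hk)

theorem norm_I_mul_ofReal_cpow (k c : ℝ) : ‖(Complex.I * (k : ℂ)) ^ (c : ℂ)‖ = |k| ^ c := by
  rw [Complex.norm_cpow_real]
  simp

theorem hasDerivAt_I_mul_ofReal_cpow {k : ℝ} (hk : k ≠ 0) (c : ℝ) :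
    HasDerivAt (fun k : ℝ => (Complex.I * (k : ℂ)) ^ (c : ℂ))
      (c * (Complex.I * k) ^ ((c - 1 : ℝ) : ℂ) * Complex.I) k := by
  have h := (((hasDerivAt_id (k : ℂ)).const_mul Complex.I).cpow_const (c := (c : ℂ))
    (I_mul_ofReal_mem_slitPlane hk)).comp_ofReal
  simpa using h

/-- The origin lies on the branch cut, but there the difference quotient has modulus `|t|^(c-1)`,
which tends to zero for `c > 1`. This makes the symbol differentiable at zero frequency. -/
theorem hasDerivAt_I_mul_ofReal_cpow_of_one_lt {c : ℝ} (hc : 1 < c) (k : ℝ) :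
    HasDerivAt (fun k : ℝ => (Complex.I * (k : ℂ)) ^ (c : ℂ))
      (c * (Complex.I * k) ^ ((c - 1 : ℝ) : ℂ) * Complex.I) k := by
  rcases eq_or_ne k 0 with rfl | hk
  · have h1 : ((c - 1 : ℝ) : ℂ) ≠ 0 := by exact_mod_cast (by linarith : c - 1 ≠ 0)
    have h2 : (c : ℂ) ≠ 0 := by exact_mod_cast (by linarith : c ≠ 0)
    rw [hasDerivAt_iff_tendsto_slope_zero]
    simp only [Complex.ofReal_zero, mul_zero, Complex.zero_cpow h1, Complex.zero_cpow h2,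
      zero_mul, zero_add, sub_zero]
    rw [tendsto_zero_iff_norm_tendsto_zero]
    have h3 : Tendsto (fun t : ℝ => |t| ^ (c - 1)) (𝓝[≠] 0) (𝓝 0) := by
      have : Continuous fun t : ℝ => |t| ^ (c - 1) :=
        continuous_abs.rpow_const fun x => Or.inr (by linarith)
      have h4 := this.tendsto 0
      rw [abs_zero, Real.zero_rpow (by linarith)] at h4
      exact h4.mono_left nhdsWithin_le_nhds
    refine h3.congr' ?_
    filter_upwards [self_mem_nhdsWithin] with t ht
    have ht' : 0 < |t| := abs_pos.mpr ht
    rw [norm_smul, norm_I_mul_ofReal_cpow, Real.rpow_sub_one ht'.ne', norm_inv, Real.norm_eq_abs]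
    field_simp
  · exact hasDerivAt_I_mul_ofReal_cpow hk c

theorem abs_im_I_mul_ofReal (k : ℝ) : |(Complex.I * (k : ℂ)).im| = |k| := by simp

theorem hasDerivAt_puncturedLatticeSum {b : ℝ} (hb : 1 < b) {k : ℝ} (hk : |k| < 3) :
    ∃ D : ℂ, HasDerivAt (fun k : ℝ => puncturedLatticeSum b (Complex.I * k)) D k ∧
      ‖D‖ ≤ b * ∑' n : ℤ, |(n : ℝ)| ^ (-(b + 1)) := by
  set u : ℤ → ℝ := fun n => b * |(n : ℝ)| ^ (-(b + 1)) with hu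
  have hus : Summable u := (Real.summable_abs_int_rpow (by linarith)).mul_left b
  set g' : ℤ → ℝ → ℂ := fun n k => if n = 0 then 0 else
    (-b : ℂ) * latticePoint (Complex.I * k) n ^ (-((b + 1 : ℝ) : ℂ)) * Complex.I with hg'
  have hg'le : ∀ n, ∀ y ∈ Set.Ioo (-3 : ℝ) 3, ‖g' n y‖ ≤ u n := by
    intro n y hy
    have hy' : |(Complex.I * (y : ℂ)).im| ≤ 3 := by
      rw [abs_im_I_mul_ofReal]
      exact (abs_lt.mpr ⟨hy.1, hy.2⟩).le
    simp only [hg', hu]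
    split_ifs with hn
    · rw [norm_zero]; positivity
    · rw [norm_mul, norm_mul, Complex.norm_I, mul_one, norm_neg, Complex.norm_real,
        Real.norm_of_nonneg (by linarith : 0 ≤ b)]
      exact mul_le_mul_of_nonneg_left (norm_latticePoint_cpow_le hy' hn (by linarith))
        (by linarith)
  have hder : ∀ n, ∀ y ∈ Set.Ioo (-3 : ℝ) 3, HasDerivAt (fun k : ℝ => if n = 0 then (0 : ℂ) else
      latticePoint (Complex.I * k) n ^ (-b : ℂ)) (g' n y) y := by
    intro n y hy
    have hy' : |(Complex.I * (y : ℂ)).im| ≤ 3 := by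
      rw [abs_im_I_mul_ofReal]
      exact (abs_lt.mpr ⟨hy.1, hy.2⟩).le
    simp only [hg']
    by_cases hn : n = 0
    · simp only [hn, if_true]
      exact hasDerivAt_const y (0 : ℂ)
    · simp only [hn, if_false]
      have h := ((((hasDerivAt_id (y : ℂ)).const_mul Complex.I).add_const
        (2 * Real.pi * Complex.I * n)).cpow_const (c := (-b : ℂ))
        (latticePoint_mem_slitPlane hy' hn)).comp_ofReal
      simp only [mul_one, id] at h
      have e : (-((b + 1 : ℝ) : ℂ)) = -b - 1 := by push_cast; ring
      rw [e]
      exact h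
  have hk' : k ∈ Set.Ioo (-3 : ℝ) 3 := abs_lt.mp hk
  have h := hasDerivAt_tsum_of_isPreconnected hus isOpen_Ioo isPreconnected_Ioo hder hg'le hk'
    (Summable.of_norm_bounded (Real.summable_abs_int_rpow hb) fun n =>
      norm_puncturedLattice_term_le (by rw [abs_im_I_mul_ofReal]; exact hk.le) n (by linarith)) hk'
  refine ⟨_, h, ?_⟩
  rw [← tsum_mul_left]
  exact tsum_of_norm_bounded hus.hasSum fun n => hg'le n k hk'

theorem tendsto_puncturedLatticeSum {b : ℝ} (hb : 1 < b) {k : ℝ} (hk : |k| ≤ 3) :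
    Tendsto (fun ε : ℝ => puncturedLatticeSum b (ε + Complex.I * k)) (𝓝[>] 0)
      (𝓝 (puncturedLatticeSum b (Complex.I * k))) := by
  refine tendsto_tsum_of_dominated_convergence (Real.summable_abs_int_rpow hb) (fun n => ?_) ?_
  · by_cases hn : n = 0
    · simp [hn]
    · simp only [hn, if_false]
      have h1 : ContinuousAt (fun z : ℂ => latticePoint z n ^ (-b : ℂ)) (Complex.I * k) := by
        refine ContinuousAt.cpow (by unfold latticePoint; fun_prop) continuousAt_const
          (latticePoint_mem_slitPlane (by rwa [abs_im_I_mul_ofReal]) hn)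
      have h2 : Tendsto (fun ε : ℝ => (ε : ℂ) + Complex.I * k) (𝓝[>] 0) (𝓝 (Complex.I * k)) := by
        have : Continuous fun ε : ℝ => (ε : ℂ) + Complex.I * k := by fun_prop
        have h3 := this.tendsto 0
        simp only [Complex.ofReal_zero, zero_add] at h3
        exact h3.mono_left nhdsWithin_le_nhds
      exact h1.tendsto.comp h2
  · refine Eventually.of_forall fun ε n => norm_puncturedLattice_term_le ?_ n (by linarith)
    simpa using hk

theorem tendsto_weightSeries {α : ℝ} (h1 : 1 < α) (h2 : α ≤ 2) (k : ℝ) :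
    Tendsto (fun ε : ℝ => weightSeries α (Complex.exp (-(ε + Complex.I * k)))) (𝓝[>] 0)
      (𝓝 (weightSeries α (Complex.exp (-(Complex.I * k))))) := by
  refine tendsto_tsum_of_dominated_convergence (summable_abs_schemeWeight h1 h2) (fun n => ?_) ?_
  · have : Continuous fun ε : ℝ => (schemeWeight α n : ℂ) *
        Complex.exp (-((ε : ℂ) + Complex.I * k)) ^ n := by fun_prop
    have h3 := this.tendsto 0
    simp only [Complex.ofReal_zero, zero_add] at h3
    exact h3.mono_left nhdsWithin_le_nhds
  · filter_upwards [self_mem_nhdsWithin] with ε hε n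
    refine norm_weight_term_le α ?_ n
    rw [Complex.norm_exp]
    simpa using le_of_lt hε

/-- Boundary limit of the identity on `Re s > 0`: both series converge by domination, the weight
series because the weights are absolutely summable. -/
theorem weightSeries_mul_lattice {α : ℝ} (h1 : 1 < α) (h2 : α ≤ 2) {k : ℝ} (hk0 : k ≠ 0)
    (hk : |k| ≤ 3) :
    weightSeries α (Complex.exp (-(Complex.I * k))) * Complex.exp (Complex.I * k) *
      ((Complex.I * k) ^ (-α : ℂ) + puncturedLatticeSum α (Complex.I * k)) = 1 := by
  have hlim : Tendsto (fun ε : ℝ => (ε : ℂ) + Complex.I * k) (𝓝[>] 0) (𝓝 (Complex.I * k)) := by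
    have : Continuous fun ε : ℝ => (ε : ℂ) + Complex.I * k := by fun_prop
    have h3 := this.tendsto 0
    simp only [Complex.ofReal_zero, zero_add] at h3
    exact h3.mono_left nhdsWithin_le_nhds
  have hpow : Tendsto (fun ε : ℝ => ((ε : ℂ) + Complex.I * k) ^ (-α : ℂ)) (𝓝[>] 0)
      (𝓝 ((Complex.I * k) ^ (-α : ℂ))) :=
    (continuousAt_id.cpow continuousAt_const (I_mul_ofReal_mem_slitPlane hk0)).tendsto.comp hlim
  have h := (((tendsto_weightSeries h1 h2 k).mul ((Complex.continuous_exp.tendsto _).comp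
    hlim))).mul (hpow.add (tendsto_puncturedLatticeSum h1 hk))
  refine tendsto_nhds_unique h (tendsto_const_nhds.congr' ?_)
  filter_upwards [self_mem_nhdsWithin] with ε hε
  exact (weightSeries_mul_lattice_of_re_pos h1 h2 (s := ε + Complex.I * k) (by simpa using hε)
    (by simpa using hk)).symm

/-- The symbol of the difference scheme of step one, relative to the fractional derivative. -/
noncomputable def schemeSymbol (α k : ℝ) : ℂ :=
  if k = 0 then 1 else weightSeries α (Complex.exp (-(Complex.I * k))) *
    Complex.exp (Complex.I * k) * (Complex.I * k) ^ (-α : ℂ)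

/-- Besides extending the identity to `k = 0`, this shows that the second factor has no zeros on
`|k| ≤ 3`, so the symbol is its reciprocal. -/
theorem schemeSymbol_mul {α : ℝ} (h1 : 1 < α) (h2 : α ≤ 2) {k : ℝ} (hk : |k| ≤ 3) :
    schemeSymbol α k *
      (1 + (Complex.I * k) ^ (α : ℂ) * puncturedLatticeSum α (Complex.I * k)) = 1 := by
  have hα : (α : ℂ) ≠ 0 := by exact_mod_cast (by linarith : α ≠ 0)
  rcases eq_or_ne k 0 with rfl | hk0
  · simp [schemeSymbol, Complex.zero_cpow hα]
  · have h := weightSeries_mul_lattice h1 h2 hk0 hk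
    have h3 : (Complex.I * (k : ℂ)) ^ (-α : ℂ) * (Complex.I * (k : ℂ)) ^ (α : ℂ) = 1 := by
      rw [← Complex.cpow_add _ _ (I_mul_ofReal_ne_zero hk0), neg_add_cancel, Complex.cpow_zero]
    rw [schemeSymbol, if_neg hk0]
    refine Eq.trans ?_ h
    linear_combination (weightSeries α (Complex.exp (-(Complex.I * k))) *
      Complex.exp (Complex.I * k) * puncturedLatticeSum α (Complex.I * k)) * h3

theorem norm_weightSeries_circle_le {α : ℝ} (h1 : 1 < α) (h2 : α ≤ 2) (k : ℝ) :
    ‖weightSeries α (Complex.exp (-(Complex.I * k)))‖ ≤ ∑' m, |schemeWeight α m| := by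
  refine tsum_of_norm_bounded (summable_abs_schemeWeight h1 h2).hasSum
    (norm_weight_term_le α ?_)
  rw [Complex.norm_exp]
  simp

theorem hasDerivAt_weightSeries_circle {α : ℝ} (h1 : 1 < α) (h2 : α ≤ 2) (k : ℝ) :
    ∃ D : ℂ, HasDerivAt (fun k : ℝ => weightSeries α (Complex.exp (-(Complex.I * k)))) D k ∧
      ‖D‖ ≤ ∑' m : ℕ, ((m : ℝ) + 1) * |schemeWeight α m| := by
  have hs := summable_mul_abs_schemeWeight h1 h2
  set g' : ℕ → ℝ → ℂ := fun m k => (schemeWeight α m : ℂ) *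
    (Complex.exp (m * -(Complex.I * k)) * (m * -Complex.I)) with hg'
  have hle : ∀ m y, ‖g' m y‖ ≤ ((m : ℝ) + 1) * |schemeWeight α m| := by
    intro m y
    simp only [hg', norm_mul, Complex.norm_real, Complex.norm_exp, norm_neg, Complex.norm_I,
      Complex.norm_natCast, Real.norm_eq_abs]
    simp
    nlinarith [abs_nonneg (schemeWeight α m)]
  have hder : ∀ m y, HasDerivAt (fun k : ℝ => (schemeWeight α m : ℂ) *
      Complex.exp (-(Complex.I * k)) ^ m) (g' m y) y := by
    intro m y
    have h := ((((((hasDerivAt_id (y : ℂ)).const_mul Complex.I).neg).const_mul (m : ℂ)).cexp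
      ).const_mul (schemeWeight α m : ℂ)).comp_ofReal
    simp only [id, mul_one] at h
    simp only [← Complex.exp_nat_mul]
    exact h
  have h := hasDerivAt_tsum hs hder hle (y₀ := k) (Summable.of_norm_bounded
    (summable_abs_schemeWeight h1 h2) (norm_weight_term_le α (by
      rw [Complex.norm_exp]
      simp))) k
  exact ⟨_, h, tsum_of_norm_bounded hs.hasSum fun m => hle m k⟩

/-! ### The symbol is a multiplier -/

theorem exists_isL1Multiplier_of_decay {m : ℝ → ℂ} {A r : ℝ} (hr : 1 < r)
    (h : ∀ k, ∃ D, HasDerivAt m D k ∧ (|k| ≤ 1 → ‖m k‖ ≤ A ∧ ‖D‖ ≤ A) ∧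
      (1 ≤ |k| → ‖m k‖ ≤ A * |k| ^ (-r) ∧ ‖D‖ ≤ A * |k| ^ (-r))) :
    ∃ C, IsL1Multiplier C m := by
  have hd : Differentiable ℝ m := fun k => by
    obtain ⟨D, hD, -⟩ := h k
    exact hD.differentiableAt
  have hA : 0 ≤ A := by
    obtain ⟨D, -, hD, -⟩ := h 0
    exact (norm_nonneg _).trans (hD (by simp)).2
  -- The factor `2^r` absorbs `1 + |k| ≤ 2` for `|k| ≤ 1`, and `1 + |k| ≤ 2|k|` for `|k| ≥ 1`.
  have near : ∀ k : ℝ, |k| ≤ 1 → A ≤ A * 2 ^ r * (1 + |k|) ^ (-r) := by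
    intro k hk
    rw [mul_assoc]
    refine le_mul_of_one_le_right hA ?_
    rw [Real.rpow_neg (by positivity), ← div_eq_mul_inv, one_le_div (by positivity)]
    exact Real.rpow_le_rpow (by positivity) (by linarith) (by linarith)
  have far : ∀ k : ℝ, 1 ≤ |k| → A * |k| ^ (-r) ≤ A * 2 ^ r * (1 + |k|) ^ (-r) := by
    intro k hk
    have hk0 : 0 < |k| := by linarith
    rw [mul_assoc]
    refine mul_le_mul_of_nonneg_left ?_ hA
    have : (2 : ℝ) ^ r = ((2 : ℝ)⁻¹) ^ (-r) := by
      rw [Real.rpow_neg (by norm_num), Real.inv_rpow (by norm_num), inv_inv]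
    rw [this, ← Real.mul_rpow (by norm_num) (by positivity)]
    exact Real.rpow_le_rpow_of_nonpos (by positivity) (by linarith) (by linarith)
  obtain ⟨K, hK, hKm⟩ := exists_fourierHat_eq_of_decay (C := A * 2 ^ r) hr hd
    (fun k => by
      obtain ⟨D, -, h0, h1⟩ := h k
      rcases le_total |k| 1 with hk | hk
      · exact (h0 hk).1.trans (near k hk)
      · exact (h1 hk).1.trans (far k hk))
    (fun k => by
      obtain ⟨D, hD, h0, h1⟩ := h k
      rw [hD.deriv]
      rcases le_total |k| 1 with hk | hk
      · exact (h0 hk).2.trans (near k hk)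
      · exact (h1 hk).2.trans (far k hk))
  exact ⟨_, (IsL1Multiplier.of_fourierHat hK).congr fun k _ => (hKm k).symm⟩

/-- Here the symbol is `1/N` with `N = 1 + (ik)^α p(ik)` differentiable, the origin included.
Compactness bounds `1/N` on `|k| ≤ 1`, and then the derivative `-N'/N²` is bounded too. -/
theorem schemeSymbol_near {α : ℝ} (h1 : 1 < α) (h2 : α ≤ 2) :
    ∃ A : ℝ, ∀ k : ℝ, |k| < 3 → ∃ D, HasDerivAt (schemeSymbol α) D k ∧
      (|k| ≤ 1 → ‖schemeSymbol α k‖ ≤ A ∧ ‖D‖ ≤ A) := by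
  set N : ℝ → ℂ := fun k =>
    1 + (Complex.I * k) ^ (α : ℂ) * puncturedLatticeSum α (Complex.I * k) with hN
  set G := ∑' n : ℤ, |(n : ℝ)| ^ (-α) with hG
  set G' := α * ∑' n : ℤ, |(n : ℝ)| ^ (-(α + 1)) with hG'
  have hG0 : 0 ≤ G := tsum_nonneg fun n => by positivity
  have hNd : ∀ k : ℝ, |k| < 3 → ∃ D, HasDerivAt N D k ∧ (|k| ≤ 1 → ‖D‖ ≤ α * G + G') := by
    intro k hk
    obtain ⟨D, hD, hDle⟩ := hasDerivAt_puncturedLatticeSum h1 hk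
    refine ⟨_, ((hasDerivAt_I_mul_ofReal_cpow_of_one_lt h1 k).mul hD).const_add 1, fun hk1 => ?_⟩
    have hp : ∀ c : ℝ, 0 ≤ c → ‖(Complex.I * (k : ℂ)) ^ (c : ℂ)‖ ≤ 1 := fun c hc => by
      rw [norm_I_mul_ofReal_cpow]
      exact Real.rpow_le_one (abs_nonneg k) hk1 hc
    have hg : ‖puncturedLatticeSum α (Complex.I * k)‖ ≤ G :=
      norm_puncturedLatticeSum_le (by rw [abs_im_I_mul_ofReal]; exact hk.le) h1
    refine (norm_add_le _ _).trans (add_le_add ?_ ?_)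
    · rw [norm_mul, norm_mul, norm_mul, Complex.norm_I, mul_one, Complex.norm_real,
        Real.norm_of_nonneg (by linarith)]
      exact mul_le_mul (mul_le_of_le_one_right (by linarith) (hp _ (by linarith))) hg
        (norm_nonneg _) (by linarith)
    · rw [norm_mul]
      exact (mul_le_of_le_one_left (norm_nonneg _) (hp _ (by linarith))).trans hDle
  have hφN : ∀ k : ℝ, |k| ≤ 3 → schemeSymbol α k * N k = 1 := fun k hk => schemeSymbol_mul h1 h2 hk
  have hφ : ∀ k : ℝ, |k| < 3 → ∀ D, HasDerivAt N D k →
      HasDerivAt (schemeSymbol α) (-D / N k ^ 2) k := by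
    intro k hk D hD
    have hNk : N k ≠ 0 := right_ne_zero_of_mul_eq_one (hφN k hk.le)
    refine (hD.fun_inv hNk).congr_of_eventuallyEq ?_
    have hev : ∀ᶠ y : ℝ in 𝓝 k, |y| < 3 := continuous_abs.continuousAt.eventually_lt_const hk
    filter_upwards [hev] with y hy
    exact eq_inv_of_mul_eq_one_left (hφN y hy.le)
  have hcont : ContinuousOn (schemeSymbol α) (Set.Icc (-1) 1) := by
    intro k hk
    have hk3 : |k| < 3 := by
      have := abs_le.mpr hk
      linarith
    obtain ⟨D, hD, -⟩ := hNd k hk3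
    exact (hφ k hk3 D hD).continuousAt.continuousWithinAt
  obtain ⟨B, hB⟩ := isCompact_Icc.exists_bound_of_continuousOn hcont
  have hB0 : 0 ≤ B := (norm_nonneg _).trans (hB 0 (by simp))
  refine ⟨max B ((α * G + G') * B ^ 2), fun k hk => ?_⟩
  obtain ⟨D, hD, hDle⟩ := hNd k hk
  refine ⟨_, hφ k hk D hD, fun hk1 => ?_⟩
  have hBk := hB k (abs_le.mp hk1)
  refine ⟨hBk.trans (le_max_left _ _), le_trans ?_ (le_max_right _ _)⟩
  have hinv : (N k)⁻¹ = schemeSymbol α k := (eq_inv_of_mul_eq_one_left (hφN k hk.le)).symm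
  rw [div_eq_mul_inv, ← inv_pow, hinv, norm_mul, norm_neg, norm_pow]
  exact mul_le_mul (hDle hk1) (pow_le_pow_left₀ (norm_nonneg _) hBk 2) (by positivity)
    ((norm_nonneg _).trans (hDle hk1))

theorem abs_rpow_le_of_one_le {k : ℝ} (hk : 1 ≤ |k|) {a b : ℝ} (hab : a ≤ b) :
    |k| ^ a ≤ |k| ^ b :=
  Real.rpow_le_rpow_of_exponent_le hk hab

/-- `W(e^(-ik)) e^(ik)` is bounded with bounded derivative, by summability of the weights against `m
+ 1`, so the decay is that of `(ik)^(-α)`. -/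
theorem schemeSymbol_far {α : ℝ} (h1 : 1 < α) (h2 : α ≤ 2) :
    ∃ A : ℝ, ∀ k : ℝ, 1 ≤ |k| → ∃ D, HasDerivAt (schemeSymbol α) D k ∧
      ‖schemeSymbol α k‖ ≤ A * |k| ^ (-α) ∧ ‖D‖ ≤ A * |k| ^ (-α) := by
  set S := ∑' m, |schemeWeight α m| with hS
  set S' := ∑' m : ℕ, ((m : ℝ) + 1) * |schemeWeight α m| with hS'
  have hS0 : 0 ≤ S := tsum_nonneg fun n => abs_nonneg _
  have hS'0 : 0 ≤ S' := tsum_nonneg fun n => by positivity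
  refine ⟨S' + S + S * α, fun k hk => ?_⟩
  have hk0 : k ≠ 0 := by
    rintro rfl
    norm_num at hk
  obtain ⟨D, hD, hDle⟩ := hasDerivAt_weightSeries_circle h1 h2 k
  have hV := norm_weightSeries_circle_le h1 h2 k
  have he : HasDerivAt (fun k : ℝ => Complex.exp (Complex.I * k))
      (Complex.exp (Complex.I * k) * Complex.I) k := by
    have := (((hasDerivAt_id (k : ℂ)).const_mul Complex.I).cexp).comp_ofReal
    simpa using this
  have hen : ‖Complex.exp (Complex.I * (k : ℂ))‖ = 1 := by
    rw [Complex.norm_exp]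
    simp
  have hp := hasDerivAt_I_mul_ofReal_cpow hk0 (-α)
  have hk' : 0 ≤ |k| ^ (-α) := by positivity
  have hsym : ∀ y : ℝ, y ≠ 0 → schemeSymbol α y = weightSeries α (Complex.exp (-(Complex.I * y))) *
      Complex.exp (Complex.I * y) * (Complex.I * y) ^ ((-α : ℝ) : ℂ) := fun y hy => by
    rw [schemeSymbol, if_neg hy, Complex.ofReal_neg]
  refine ⟨_, ((hD.fun_mul he).fun_mul hp).congr_of_eventuallyEq ?_, ?_, ?_⟩
  · filter_upwards [isOpen_ne.mem_nhds hk0] with y hy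
    exact hsym y hy
  · rw [hsym k hk0, norm_mul, norm_mul, hen, mul_one, norm_I_mul_ofReal_cpow]
    refine mul_le_mul_of_nonneg_right ?_ hk'
    nlinarith
  · have e1 : ‖weightSeries α (Complex.exp (-(Complex.I * k))) * (Complex.exp (Complex.I * k) *
        Complex.I)‖ ≤ S := by
      rw [norm_mul, norm_mul, hen, Complex.norm_I, one_mul, mul_one]
      exact hV
    have e2 : ‖D * Complex.exp (Complex.I * k)‖ ≤ S' := by
      rw [norm_mul, hen, mul_one]
      exact hDle
    have e3 : ‖weightSeries α (Complex.exp (-(Complex.I * k))) * Complex.exp (Complex.I * k)‖ ≤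
        S := by
      rw [norm_mul, hen, mul_one]
      exact hV
    have e4 : ‖((-α : ℝ) : ℂ) * (Complex.I * (k : ℂ)) ^ ((-α - 1 : ℝ) : ℂ) * Complex.I‖ ≤
        α * |k| ^ (-α) := by
      rw [norm_mul, norm_mul, norm_I_mul_ofReal_cpow, Complex.norm_I, mul_one, Complex.norm_real,
        Real.norm_eq_abs, abs_neg, abs_of_pos (by linarith)]
      exact mul_le_mul_of_nonneg_left (abs_rpow_le_of_one_le hk (by linarith)) (by linarith)
    refine (norm_add_le _ _).trans ?_
    rw [norm_mul, norm_mul (_ * _) (_ * _ * _), norm_I_mul_ofReal_cpow]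
    calc _ ≤ (S' + S) * |k| ^ (-α) + S * (α * |k| ^ (-α)) := by
          refine add_le_add (mul_le_mul_of_nonneg_right ?_ hk') (mul_le_mul e3 e4
            (norm_nonneg _) hS0)
          exact (norm_add_le _ _).trans (add_le_add e2 e1)
      _ = _ := by ring

theorem exists_isL1Multiplier_schemeSymbol {α : ℝ} (h1 : 1 < α) (h2 : α ≤ 2) :
    ∃ C, IsL1Multiplier C (schemeSymbol α) := by
  obtain ⟨A, hA⟩ := schemeSymbol_near h1 h2
  obtain ⟨B, hB⟩ := schemeSymbol_far h1 h2
  refine exists_isL1Multiplier_of_decay (A := max A B) h1 fun k => ?_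
  have hmax : ∀ k : ℝ, B * |k| ^ (-α) ≤ max A B * |k| ^ (-α) := fun k =>
    mul_le_mul_of_nonneg_right (le_max_right _ _) (by positivity)
  rcases le_total |k| 1 with hk | hk
  · obtain ⟨D, hD, hle⟩ := hA k (by linarith)
    refine ⟨D, hD, fun _ => ⟨(hle hk).1.trans (le_max_left _ _),
      (hle hk).2.trans (le_max_left _ _)⟩, fun hk' => ?_⟩
    obtain ⟨D', hD', l1, l2⟩ := hB k hk'
    -- Both descriptions apply when `|k| = 1`; uniqueness identifies their derivatives.
    rw [hD.unique hD']
    exact ⟨l1.trans (hmax k), l2.trans (hmax k)⟩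
  · obtain ⟨D', hD', l1, l2⟩ := hB k hk
    refine ⟨D', hD', fun hk' => ?_, fun _ => ⟨l1.trans (hmax k), l2.trans (hmax k)⟩⟩
    obtain ⟨D, hD, hle⟩ := hA k (by linarith)
    rw [← hD.unique hD']
    exact ⟨(hle hk').1.trans (le_max_left _ _), (hle hk').2.trans (le_max_left _ _)⟩

/-- The symbol of the error of the difference scheme, divided by `(ik)^α`. -/
noncomputable def errorSymbol (α k : ℝ) : ℂ :=
  if k = 0 then -puncturedLatticeSum α 0
  else (schemeSymbol α k - 1) * (Complex.I * k) ^ ((-α : ℝ) : ℂ)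

/-- From `φ - 1 = -(ik)^α p φ` the singular factor cancels exactly, which also explains the value
assigned at `k = 0`. -/
theorem errorSymbol_near_eq {α : ℝ} (h1 : 1 < α) (h2 : α ≤ 2) {k : ℝ} (hk : |k| ≤ 3) :
    errorSymbol α k = -(puncturedLatticeSum α (Complex.I * k) * schemeSymbol α k) := by
  rcases eq_or_ne k 0 with rfl | hk0
  · simp [errorSymbol, schemeSymbol]
  · have h := schemeSymbol_mul h1 h2 hk
    have h3 : (Complex.I * (k : ℂ)) ^ ((-α : ℝ) : ℂ) * (Complex.I * (k : ℂ)) ^ (α : ℂ) = 1 := by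
      rw [← Complex.cpow_add _ _ (I_mul_ofReal_ne_zero hk0), Complex.ofReal_neg, neg_add_cancel,
        Complex.cpow_zero]
    rw [errorSymbol, if_neg hk0]
    linear_combination (Complex.I * (k : ℂ)) ^ ((-α : ℝ) : ℂ) * h -
      schemeSymbol α k * puncturedLatticeSum α (Complex.I * k) * h3

theorem exists_isL1Multiplier_errorSymbol {α : ℝ} (h1 : 1 < α) (h2 : α ≤ 2) :
    ∃ C, IsL1Multiplier C (errorSymbol α) := by
  obtain ⟨A, hA⟩ := schemeSymbol_near h1 h2
  obtain ⟨B, hB⟩ := schemeSymbol_far h1 h2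
  set G := ∑' n : ℤ, |(n : ℝ)| ^ (-α) with hG
  set G' := α * ∑' n : ℤ, |(n : ℝ)| ^ (-(α + 1)) with hG'
  have hG0 : 0 ≤ G := tsum_nonneg fun n => by positivity
  have hnear : ∀ k : ℝ, |k| ≤ 1 → ∃ D, HasDerivAt (errorSymbol α) D k ∧
      ‖errorSymbol α k‖ ≤ G * A + G' * A ∧ ‖D‖ ≤ G * A + G' * A := by
    intro k hk
    have hk3 : |k| < 3 := by linarith
    obtain ⟨D, hD, hle⟩ := hA k hk3
    obtain ⟨l1, l2⟩ := hle hk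
    obtain ⟨E, hE, hEle⟩ := hasDerivAt_puncturedLatticeSum h1 hk3
    have hg : ‖puncturedLatticeSum α (Complex.I * k)‖ ≤ G :=
      norm_puncturedLatticeSum_le (by rw [abs_im_I_mul_ofReal]; exact hk3.le) h1
    have hA0 : 0 ≤ A := (norm_nonneg _).trans l1
    have hG'0 : 0 ≤ G' := (norm_nonneg _).trans hEle
    refine ⟨_, (hE.mul hD).neg.congr_of_eventuallyEq ?_, ?_, ?_⟩
    · have hev : ∀ᶠ y : ℝ in 𝓝 k, |y| < 3 := continuous_abs.continuousAt.eventually_lt_const hk3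
      filter_upwards [hev] with y hy
      exact errorSymbol_near_eq h1 h2 hy.le
    · rw [errorSymbol_near_eq h1 h2 hk3.le, norm_neg, norm_mul]
      have := mul_le_mul hg l1 (norm_nonneg _) hG0
      have := mul_nonneg hG'0 hA0
      linarith
    · rw [norm_neg]
      refine (norm_add_le _ _).trans ?_
      rw [norm_mul, norm_mul]
      have t1 := mul_le_mul hg l2 (norm_nonneg _) hG0
      have t2 := mul_le_mul hEle l1 (norm_nonneg _) hG'0
      linarith
  have hfar : ∀ k : ℝ, 1 ≤ |k| → ∃ D, HasDerivAt (errorSymbol α) D k ∧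
      ‖errorSymbol α k‖ ≤ (B + (B + 1) * α + 1) * |k| ^ (-α) ∧
      ‖D‖ ≤ (B + (B + 1) * α + 1) * |k| ^ (-α) := by
    intro k hk
    have hk0 : k ≠ 0 := by
      rintro rfl
      norm_num at hk
    obtain ⟨D, hD, l1, l2⟩ := hB k hk
    have hkα : 0 < |k| ^ (-α) := Real.rpow_pos_of_pos (by linarith) _
    have hk1 : |k| ^ (-α) ≤ 1 := Real.rpow_le_one_of_one_le_of_nonpos hk (by linarith)
    have hB0 : 0 ≤ B := nonneg_of_mul_nonneg_left ((norm_nonneg _).trans l1) hkα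
    have hp := hasDerivAt_I_mul_ofReal_cpow hk0 (-α)
    have hφ1 : ‖schemeSymbol α k - 1‖ ≤ B + 1 := by
      refine (norm_sub_le _ _).trans ?_
      rw [norm_one]
      have := mul_le_of_le_one_right hB0 hk1
      linarith
    have e4 : ‖((-α : ℝ) : ℂ) * (Complex.I * (k : ℂ)) ^ ((-α - 1 : ℝ) : ℂ) * Complex.I‖ ≤
        α * |k| ^ (-α) := by
      rw [norm_mul, norm_mul, norm_I_mul_ofReal_cpow, Complex.norm_I, mul_one, Complex.norm_real,
        Real.norm_eq_abs, abs_neg, abs_of_pos (by linarith)]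
      exact mul_le_mul_of_nonneg_left (abs_rpow_le_of_one_le hk (by linarith)) (by linarith)
    refine ⟨_, ((hD.sub_const 1).mul hp).congr_of_eventuallyEq ?_, ?_, ?_⟩
    · filter_upwards [isOpen_ne.mem_nhds hk0] with y hy
      rw [errorSymbol, if_neg hy]
      rfl
    · rw [errorSymbol, if_neg hk0, norm_mul, norm_I_mul_ofReal_cpow]
      refine mul_le_mul_of_nonneg_right ?_ hkα.le
      nlinarith
    · refine (norm_add_le _ _).trans ?_
      rw [norm_mul, norm_mul (schemeSymbol α k - 1), norm_I_mul_ofReal_cpow]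
      calc _ ≤ B * |k| ^ (-α) + (B + 1) * (α * |k| ^ (-α)) := by
            refine add_le_add (mul_le_mul_of_nonneg_right ?_ hkα.le) (mul_le_mul hφ1 e4
              (norm_nonneg _) (by linarith))
            exact l2.trans (mul_le_of_le_one_right hB0 hk1)
        _ ≤ _ := by nlinarith
  refine exists_isL1Multiplier_of_decay
    (A := max (G * A + G' * A) (B + (B + 1) * α + 1)) h1 fun k => ?_
  have hmax : ∀ k : ℝ, (B + (B + 1) * α + 1) * |k| ^ (-α) ≤
      max (G * A + G' * A) (B + (B + 1) * α + 1) * |k| ^ (-α) := fun k =>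
    mul_le_mul_of_nonneg_right (le_max_right _ _) (by positivity)
  rcases le_total |k| 1 with hk | hk
  · obtain ⟨D, hD, n1, n2⟩ := hnear k hk
    refine ⟨D, hD, fun _ => ⟨n1.trans (le_max_left _ _), n2.trans (le_max_left _ _)⟩,
      fun hk' => ?_⟩
    obtain ⟨D', hD', l1, l2⟩ := hfar k hk'
    rw [hD.unique hD']
    exact ⟨l1.trans (hmax k), l2.trans (hmax k)⟩
  · obtain ⟨D', hD', l1, l2⟩ := hfar k hk
    refine ⟨D', hD', fun hk' => ?_, fun _ => ⟨l1.trans (hmax k), l2.trans (hmax k)⟩⟩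
    obtain ⟨D, hD, n1, n2⟩ := hnear k hk'
    rw [← hD.unique hD']
    exact ⟨n1.trans (le_max_left _ _), n2.trans (le_max_left _ _)⟩

/-! ### Powers of the resolvent symbol -/

theorem one_add_I_mul_ne_zero (k : ℝ) : 1 + Complex.I * (k : ℂ) ≠ 0 := fun h => by
  have := congrArg Complex.re h
  simp at this

/-- The kernel `e^(-x)` on `x > 0` has `L¹` norm exactly one. Its powers keep norm at most one, so
the binomial series can be summed. -/
theorem isL1Multiplier_resolvent :
    IsL1Multiplier 1 fun k : ℝ => (1 + Complex.I * (k : ℂ))⁻¹ := by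
  have h := IsL1Multiplier.of_fourierHat (integrable_dampedPower (a := 1) (s := 1) one_pos
    (by simp))
  have hn : ∫ x, ‖dampedPower 1 1 x‖ = 1 := by
    have : ∀ x, ‖dampedPower 1 1 x‖ = (Set.Ioi 0).indicator (fun t : ℝ => Real.exp (-t)) x := by
      intro x
      rw [dampedPower, norm_indicator_eq_indicator_norm]
      congr 1
      ext t
      simp [Complex.norm_exp]
    simp only [this]
    rw [integral_indicator measurableSet_Ioi, integral_exp_neg_Ioi_zero]
  rw [hn] at h
  refine h.congr fun k _ => ?_
  rw [fourierHat_dampedPower one_pos (by simp)]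
  simp [Complex.cpow_neg_one]

theorem exists_isL1Multiplier_resolvent_cpow {γ : ℝ} (hγ : 0 ≤ γ) :
    ∃ C, IsL1Multiplier C fun k : ℝ => (1 + Complex.I * (k : ℂ)) ^ (-γ : ℂ) := by
  rcases hγ.eq_or_lt with rfl | h0
  · exact ⟨_, (IsL1Multiplier.const 1).congr fun k _ => by simp⟩
  · have hΓ : (Real.Gamma γ : ℂ) ≠ 0 := by exact_mod_cast (Real.Gamma_pos_of_pos h0).ne'
    refine ⟨_, ((IsL1Multiplier.of_fourierHat (integrable_dampedPower (s := 1) h0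
      (by simp))).const_mul (Real.Gamma γ : ℂ)⁻¹).congr fun k _ => ?_⟩
    rw [fourierHat_dampedPower h0 (by simp)]
    field_simp

/-! ### The binomial series for exponents in `(0, 1)` -/

theorem succ_mul_choose (r : ℝ) (n : ℕ) :
    ((n : ℝ) + 1) * Ring.choose r (n + 1) = Ring.choose r n * (r - n) := by
  have h := Ring.choose_smul_choose r (Nat.le_succ n)
  simp only [Nat.succ_eq_add_one, Nat.choose_succ_self_right, Nat.add_sub_cancel_left,
    Ring.choose_one_right, nsmul_eq_mul] at h
  push_cast at h
  exact h

/-- The numbers `b n = (-1)^n * Ring.choose (γ - 1) n` are nonnegative and decreasing, and Pascal's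
rule gives `|Ring.choose γ (n+1)| = b n - b (n+1)`, a telescoping series. -/
theorem summable_abs_choose {γ : ℝ} (h0 : 0 ≤ γ) (h1 : γ ≤ 1) :
    Summable fun n : ℕ => |Ring.choose γ n| := by
  set b : ℕ → ℝ := fun n => (-1) ^ n * Ring.choose (γ - 1) n with hb
  have hrec : ∀ n : ℕ, ((n : ℝ) + 1) * b (n + 1) = (n + 1 - γ) * b n := by
    intro n
    have := succ_mul_choose (γ - 1) n
    simp only [hb, pow_succ]
    linear_combination (-(-1) ^ n) * this
  have hpos : ∀ n, 0 ≤ b n := by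
    intro n
    induction n with
    | zero => simp [hb]
    | succ n ih =>
      have hn : (0 : ℝ) ≤ n := Nat.cast_nonneg n
      refine nonneg_of_mul_nonneg_right (a := (n : ℝ) + 1) ?_ (by linarith)
      rw [hrec]
      exact mul_nonneg (by linarith) ih
  have hanti : ∀ n, b (n + 1) ≤ b n := by
    intro n
    have hn : (0 : ℝ) < (n : ℝ) + 1 := by positivity
    refine le_of_mul_le_mul_left ?_ hn
    rw [hrec]
    exact mul_le_mul_of_nonneg_right (by linarith) (hpos n)
  have habs : ∀ n, |Ring.choose γ (n + 1)| = b n - b (n + 1) := by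
    intro n
    have h := Ring.choose_succ_succ (γ - 1) n
    rw [sub_add_cancel] at h
    have h2 : b n - b (n + 1) = (-1) ^ n * Ring.choose γ (n + 1) := by
      rw [h]
      simp only [hb, pow_succ]
      ring
    have h3 := abs_of_nonneg (sub_nonneg.mpr (hanti n))
    rw [← h3, h2, abs_mul, abs_pow, abs_neg, abs_one, one_pow, one_mul]
  rw [← summable_nat_add_iff 1]
  refine summable_of_sum_range_le (c := 1) (fun n => abs_nonneg _) fun N => ?_
  simp only [habs]
  rw [Finset.sum_range_sub' b]
  have : b 0 = 1 := by simp [hb]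
  linarith [hpos N]

theorem hasSum_choose_mul_pow (γ : ℝ) {z : ℂ} (hz : ‖z‖ < 1) :
    HasSum (fun n : ℕ => ((Ring.choose γ n : ℝ) : ℂ) * z ^ n) ((1 + z) ^ (γ : ℂ)) := by
  have h := (Complex.one_add_cpow_hasFPowerSeriesOnBall_zero (a := (γ : ℂ))).hasSum (y := z)
    (by
      rw [Metric.mem_eball, edist_zero_right, ← ofReal_norm]
      exact ENNReal.ofReal_lt_one.mpr hz)
  simpa [binomialSeries, Complex.ofReal_choose, mul_comm] using h

/-- The base is `ik/(1+ik)`. The power splits on the principal branch because `ik` and `1/(1+ik)`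
have arguments of modulus at most, respectively below, `π/2`. -/
theorem one_sub_resolvent_cpow {k : ℝ} (hk : k ≠ 0) (γ : ℝ) :
    (1 + -(1 + Complex.I * (k : ℂ))⁻¹) ^ (γ : ℂ) =
      (Complex.I * k) ^ (γ : ℂ) * (1 + Complex.I * k) ^ (-γ : ℂ) := by
  have hs := I_mul_ofReal_ne_zero hk
  have hw := one_add_I_mul_ne_zero k
  have e : 1 + -(1 + Complex.I * (k : ℂ))⁻¹ = (Complex.I * k) * (1 + Complex.I * k)⁻¹ := by
    field_simp
    ring
  have harg1 : |(Complex.I * (k : ℂ)).arg| ≤ Real.pi / 2 :=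
    Complex.abs_arg_le_pi_div_two_iff.mpr (by simp)
  have harg2 : |(1 + Complex.I * (k : ℂ)).arg| < Real.pi / 2 :=
    Complex.abs_arg_lt_pi_div_two_iff.mpr (Or.inl (by simp))
  have hpi := Real.pi_pos
  have hne : (1 + Complex.I * (k : ℂ)).arg ≠ Real.pi := fun h => by
    rw [h, abs_of_pos hpi] at harg2
    linarith
  have hinv : (1 + Complex.I * (k : ℂ))⁻¹.arg = -(1 + Complex.I * (k : ℂ)).arg := by
    rw [Complex.arg_inv, if_neg hne]
  have h1 := abs_le.mp harg1
  have h2 := abs_lt.mp harg2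
  have hlog : Complex.log ((Complex.I * k) * (1 + Complex.I * k)⁻¹) =
      Complex.log (Complex.I * k) + Complex.log (1 + Complex.I * k)⁻¹ := by
    refine Complex.log_mul hs (inv_ne_zero hw) ?_
    rw [hinv]
    constructor <;> linarith
  rw [e, Complex.cpow_def_of_ne_zero (mul_ne_zero hs (inv_ne_zero hw)), hlog, Complex.log_inv _ hne,
    Complex.cpow_def_of_ne_zero hs, Complex.cpow_def_of_ne_zero hw, ← Complex.exp_add]
  congr 1
  ring

theorem norm_resolvent_lt_one {k : ℝ} (hk : k ≠ 0) : ‖(1 + Complex.I * (k : ℂ))⁻¹‖ < 1 := by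
  rw [norm_inv]
  refine inv_lt_one_of_one_lt₀ ?_
  have h : (1 : ℝ) ^ 2 < ‖1 + Complex.I * (k : ℂ)‖ ^ 2 := by
    rw [Complex.sq_norm, Complex.normSq_apply]
    simp
    exact hk
  exact lt_of_pow_lt_pow_left₀ 2 (norm_nonneg _) h

theorem exists_isL1Multiplier_cpow_of_le_one {γ : ℝ} (h0 : 0 ≤ γ) (h1 : γ ≤ 1) :
    ∃ C, IsL1Multiplier C fun k : ℝ =>
      (Complex.I * (k : ℂ)) ^ (γ : ℂ) * (1 + Complex.I * k) ^ (-γ : ℂ) := by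
  refine ⟨_, IsL1Multiplier.hasSum (C := fun n => |Ring.choose γ n|)
    (m := fun n k => ((Ring.choose γ n : ℝ) : ℂ) * (-(1 + Complex.I * (k : ℂ))⁻¹) ^ n) (fun n => ?_)
    (summable_abs_choose h0 h1) fun k hk => ?_⟩
  · have h := (isL1Multiplier_resolvent.const_mul (-1)).pow n |>.const_mul ((Ring.choose γ n : ℝ) : ℂ)
    simp only [norm_neg, norm_one, one_pow, mul_one, Complex.norm_real, Real.norm_eq_abs,
      neg_one_mul] at h
    exact h
  · rw [← one_sub_resolvent_cpow hk]
    exact hasSum_choose_mul_pow γ (by rw [norm_neg]; exact norm_resolvent_lt_one hk)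

/-- The multiplier is the square of the one for `γ/2 ≤ 1`. -/
theorem exists_isL1Multiplier_cpow {γ : ℝ} (h0 : 0 ≤ γ) (h2 : γ ≤ 2) :
    ∃ C, IsL1Multiplier C fun k : ℝ =>
      (Complex.I * (k : ℂ)) ^ (γ : ℂ) * (1 + Complex.I * k) ^ (-γ : ℂ) := by
  obtain ⟨C, hC⟩ := exists_isL1Multiplier_cpow_of_le_one (γ := γ / 2) (by linarith) (by linarith)
  refine ⟨_, (hC.mul hC).congr fun k hk => ?_⟩
  have e1 : (γ : ℂ) = ((γ / 2 : ℝ) : ℂ) + ((γ / 2 : ℝ) : ℂ) := by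
    push_cast
    ring
  have e2 : (-γ : ℂ) = -((γ / 2 : ℝ) : ℂ) + -((γ / 2 : ℝ) : ℂ) := by
    push_cast
    ring
  rw [e2, e1, Complex.cpow_add _ _ (I_mul_ofReal_ne_zero hk),
    Complex.cpow_add _ _ (one_add_I_mul_ne_zero k)]
  ring

/-! ### Splitting into low and high frequencies -/

/-- A low-pass filter whose complement vanishes to second order at the origin. -/
noncomputable def lowPass (k : ℝ) : ℂ :=
  (1 + 3 * (Complex.I * k)) * (1 + Complex.I * (k : ℂ)) ^ (-3 : ℂ)

/-- With `s = ik`, the filter is `(1+s)^(-2) (3 - 2/(1+s))`; its second-order decay leaves room for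
`s^a` with `a ≤ 2`. -/
theorem cpow_mul_lowPass (k a : ℝ) :
    (Complex.I * (k : ℂ)) ^ (a : ℂ) * lowPass k =
      ((Complex.I * (k : ℂ)) ^ (a : ℂ) * (1 + Complex.I * k) ^ (-a : ℂ)) *
        ((1 + Complex.I * k) ^ (-((2 - a : ℝ) : ℂ)) * (3 + -2 * (1 + Complex.I * (k : ℂ))⁻¹)) := by
  have hw := one_add_I_mul_ne_zero k
  have e : (1 + Complex.I * (k : ℂ)) ^ (-3 : ℂ) = (1 + Complex.I * k) ^ (-a : ℂ) *
      (1 + Complex.I * k) ^ (-((2 - a : ℝ) : ℂ)) * (1 + Complex.I * (k : ℂ))⁻¹ := by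
    rw [← Complex.cpow_neg_one, ← Complex.cpow_add _ _ hw, ← Complex.cpow_add _ _ hw]
    congr 1
    push_cast
    ring
  have e2 : (3 + -2 * (1 + Complex.I * (k : ℂ))⁻¹) =
      (1 + 3 * (Complex.I * k)) * (1 + Complex.I * (k : ℂ))⁻¹ := by
    field_simp
    ring
  rw [lowPass, e, e2]
  ring

/-- With `s = ik`, the complement is `s² (1+s)^(-2) (1 + 2/(1+s))`; its double zero absorbs `s^(-b)`
with `b ≤ 2`. -/
theorem cpow_mul_one_sub_lowPass {k : ℝ} (hk : k ≠ 0) (b : ℝ) :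
    (Complex.I * (k : ℂ)) ^ (-b : ℂ) * (1 - lowPass k) =
      ((Complex.I * (k : ℂ)) ^ ((2 - b : ℝ) : ℂ) * (1 + Complex.I * k) ^ (-((2 - b : ℝ) : ℂ))) *
        ((1 + Complex.I * k) ^ (-b : ℂ) * (1 + 2 * (1 + Complex.I * (k : ℂ))⁻¹)) := by
  have hw := one_add_I_mul_ne_zero k
  have hs := I_mul_ofReal_ne_zero hk
  have e : (1 + Complex.I * (k : ℂ)) ^ (-((2 - b : ℝ) : ℂ)) * (1 + Complex.I * k) ^ (-b : ℂ) =
      ((1 + Complex.I * (k : ℂ)) ^ 2)⁻¹ := by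
    rw [← Complex.cpow_add _ _ hw, show -((2 - b : ℝ) : ℂ) + -b = -(2 : ℕ) by push_cast; ring,
      Complex.cpow_neg, Complex.cpow_natCast]
  have e3 : (1 + Complex.I * (k : ℂ)) ^ (-3 : ℂ) = ((1 + Complex.I * (k : ℂ)) ^ 3)⁻¹ := by
    rw [show (-3 : ℂ) = -(3 : ℕ) by push_cast; ring, Complex.cpow_neg, Complex.cpow_natCast]
  have e4 : (Complex.I * (k : ℂ)) ^ ((2 - b : ℝ) : ℂ) =
      (Complex.I * (k : ℂ)) ^ (-b : ℂ) * (Complex.I * (k : ℂ)) ^ 2 := by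
    rw [← Complex.cpow_natCast, ← Complex.cpow_add _ _ hs]
    congr 1
    push_cast
    ring
  calc _ = (Complex.I * (k : ℂ)) ^ (-b : ℂ) * ((Complex.I * (k : ℂ)) ^ 2 *
        (((1 + Complex.I * (k : ℂ)) ^ 2)⁻¹ * (1 + 2 * (1 + Complex.I * (k : ℂ))⁻¹))) := by
        rw [lowPass, e3]
        congr 1
        field_simp
        ring
    _ = _ := by
        rw [← e, e4]
        ring

theorem exists_isL1Multiplier_low {a : ℝ} (h0 : 0 ≤ a) (h2 : a ≤ 2) :
    ∃ C, IsL1Multiplier C fun k : ℝ => (Complex.I * (k : ℂ)) ^ (a : ℂ) * lowPass k := by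
  obtain ⟨C, hC⟩ := exists_isL1Multiplier_cpow h0 h2
  obtain ⟨D, hD⟩ := exists_isL1Multiplier_resolvent_cpow (γ := 2 - a) (by linarith)
  exact ⟨_, (hC.mul (hD.mul ((IsL1Multiplier.const 3).add
    (isL1Multiplier_resolvent.const_mul (-2))))).congr fun k _ => cpow_mul_lowPass k a⟩

theorem exists_isL1Multiplier_high {b : ℝ} (h0 : 0 ≤ b) (h2 : b ≤ 2) :
    ∃ C, IsL1Multiplier C fun k : ℝ => (Complex.I * (k : ℂ)) ^ (-b : ℂ) * (1 - lowPass k) := by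
  obtain ⟨C, hC⟩ := exists_isL1Multiplier_cpow (γ := 2 - b) (by linarith) (by linarith)
  obtain ⟨D, hD⟩ := exists_isL1Multiplier_resolvent_cpow h0
  exact ⟨_, (hC.mul (hD.mul ((IsL1Multiplier.const 1).add
    (isL1Multiplier_resolvent.const_mul 2)))).congr fun k hk => cpow_mul_one_sub_lowPass hk b⟩

/-- At high frequencies `φ - 1` is paired with `(ik)^(-β)(1 - ℓ)`. At low ones `(φ - 1)(ik)^(-α)` is
paired with `(ik)^(α-β) ℓ`. Here `ℓ` is `lowPass`, and all four factors are multipliers. -/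
theorem exists_isL1Multiplier_symbol_sub_one {α β : ℝ} (h1 : 1 < α) (h2 : α ≤ 2) (h0 : 0 ≤ β)
    (hβ : β ≤ α) :
    ∃ C, IsL1Multiplier C fun k : ℝ =>
      (schemeSymbol α k - 1) * (Complex.I * (k : ℂ)) ^ (-β : ℂ) := by
  obtain ⟨A, hA⟩ := exists_isL1Multiplier_schemeSymbol h1 h2
  obtain ⟨B, hB⟩ := exists_isL1Multiplier_errorSymbol h1 h2
  obtain ⟨L, hL⟩ := exists_isL1Multiplier_low (a := α - β) (by linarith) (by linarith)
  obtain ⟨H, hH⟩ := exists_isL1Multiplier_high h0 (hβ.trans h2)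
  refine ⟨_, (((hA.add (IsL1Multiplier.const (-1))).mul hH).add (hB.mul hL)).congr
    fun k hk => ?_⟩
  have e : (Complex.I * (k : ℂ)) ^ (-β : ℂ) = (Complex.I * (k : ℂ)) ^ ((-α : ℝ) : ℂ) *
      (Complex.I * (k : ℂ)) ^ ((α - β : ℝ) : ℂ) := by
    rw [← Complex.cpow_add _ _ (I_mul_ofReal_ne_zero hk)]
    congr 1
    push_cast
    ring
  rw [errorSymbol, if_neg hk]
  linear_combination (schemeSymbol α k - 1) * lowPass k * e

/-! ### The difference scheme on `L¹` -/

theorem integrable_scheme_term (α h : ℝ) {f : ℝ → ℂ} (hf : Integrable f) (m : ℕ) :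
    Integrable fun x : ℝ => (schemeWeight α m : ℂ) * f (x - ((m : ℝ) - 1) * h) :=
  (hf.comp_sub_right _).const_mul _

theorem integral_norm_scheme_term (α h : ℝ) (f : ℝ → ℂ) (m : ℕ) :
    ∫ x : ℝ, ‖(schemeWeight α m : ℂ) * f (x - ((m : ℝ) - 1) * h)‖ =
      |schemeWeight α m| * ∫ x, ‖f x‖ := by
  simp only [norm_mul, Complex.norm_real, Real.norm_eq_abs]
  rw [integral_const_mul, integral_sub_right_eq_self (fun x => ‖f x‖)]

theorem summable_integral_norm_scheme_term {α : ℝ} (h1 : 1 < α) (h2 : α ≤ 2) (h : ℝ) (f : ℝ → ℂ) :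
    Summable fun m : ℕ => ∫ x : ℝ, ‖(schemeWeight α m : ℂ) * f (x - ((m : ℝ) - 1) * h)‖ := by
  simp only [integral_norm_scheme_term]
  exact (summable_abs_schemeWeight h1 h2).mul_right _

theorem ae_summable_scheme {α : ℝ} (h1 : 1 < α) (h2 : α ≤ 2) (h : ℝ) {f : ℝ → ℂ}
    (hf : Integrable f) : ∀ᵐ x : ℝ, Summable fun m : ℕ =>
      (schemeWeight α m : ℂ) * f (x - ((m : ℝ) - 1) * h) := by
  filter_upwards [ae_summable_of_summable_integral_norm (integrable_scheme_term α h hf)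
    (summable_integral_norm_scheme_term h1 h2 h f)] with x hx
  exact hx.of_norm

theorem integrable_scheme {α : ℝ} (h1 : 1 < α) (h2 : α ≤ 2) (h : ℝ) {f : ℝ → ℂ}
    (hf : Integrable f) : Integrable (scheme α h f) :=
  (integrable_tsum_of_summable_integral_norm (integrable_scheme_term α h hf)
    (summable_integral_norm_scheme_term h1 h2 h f)).1.const_mul _

theorem fourierHat_scheme {α : ℝ} (h1 : 1 < α) (h2 : α ≤ 2) (h : ℝ) {f : ℝ → ℂ}
    (hf : Integrable f) (k : ℝ) :
    fourierHat (scheme α h f) k = ((h ^ (-α) : ℝ) : ℂ) *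
      (weightSeries α (Complex.exp (-(Complex.I * (h * k : ℝ)))) *
        Complex.exp (Complex.I * (h * k : ℝ)) * fourierHat f k) := by
  have hs := hasSum_fourierHat (integrable_scheme_term α h hf)
    (summable_integral_norm_scheme_term h1 h2 h f) k
  unfold scheme
  rw [fourierHat_const_mul, ← hs.tsum_eq, weightSeries, ← tsum_mul_right, ← tsum_mul_right]
  congr 2 with m
  have e : Complex.exp (-(Complex.I * k * (((m : ℝ) - 1) * h : ℝ))) =
      Complex.exp (m * -(Complex.I * (h * k : ℝ))) * Complex.exp (Complex.I * (h * k : ℝ)) := by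
    rw [← Complex.exp_add]
    congr 1
    push_cast
    ring
  rw [fourierHat_const_mul, fourierHat_comp_sub_right, ← Complex.exp_nat_mul, e]
  ring

theorem mul_I_cpow {h k : ℝ} (hh : 0 < h) (hk : k ≠ 0) (c : ℝ) :
    (Complex.I * ((h * k : ℝ) : ℂ)) ^ (c : ℂ) =
      ((h ^ c : ℝ) : ℂ) * (Complex.I * (k : ℂ)) ^ (c : ℂ) := by
  have hs := I_mul_ofReal_ne_zero hk
  have hh' : (h : ℂ) ≠ 0 := by exact_mod_cast hh.ne'
  have e : Complex.I * ((h * k : ℝ) : ℂ) = h * (Complex.I * k) := by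
    push_cast
    ring
  rw [e, Complex.cpow_def_of_ne_zero (mul_ne_zero hh' hs), Complex.log_ofReal_mul hh hs,
    Complex.cpow_def_of_ne_zero hs, Complex.ofReal_cpow hh.le, Complex.cpow_def_of_ne_zero hh',
    ← Complex.exp_add, ← Complex.ofReal_log hh.le]
  congr 1
  ring

theorem fourierHat_scheme_of_isFracDeriv {α : ℝ} (h1 : 1 < α) (h2 : α ≤ 2) {h : ℝ} (hh : 0 < h)
    {f G : ℝ → ℂ} (hfG : IsFracDeriv α f G) {k : ℝ} (hk : k ≠ 0) :
    fourierHat (scheme α h f) k = schemeSymbol α (h * k) * fourierHat G k := by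
  have hinv : (Complex.I * (k : ℂ)) ^ ((-α : ℝ) : ℂ) * (Complex.I * (k : ℂ)) ^ (α : ℂ) = 1 := by
    rw [← Complex.cpow_add _ _ (I_mul_ofReal_ne_zero hk), Complex.ofReal_neg, neg_add_cancel,
      Complex.cpow_zero]
  rw [fourierHat_scheme h1 h2 h hfG.1, schemeSymbol, if_neg (mul_ne_zero hh.ne' hk), hfG.2.2 k,
    ← Complex.ofReal_neg, mul_I_cpow hh hk (-α)]
  linear_combination -(((h ^ (-α) : ℝ) : ℂ) *
      (weightSeries α (Complex.exp (-(Complex.I * (h * k : ℝ)))) *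
        Complex.exp (Complex.I * (h * k : ℝ)) * fourierHat f k)) * hinv

/-- By uniqueness of the transform, the error can be measured on any integrable function that a
multiplier supplies. -/
theorem integral_norm_scheme_sub_eq {α : ℝ} (h1 : 1 < α) (h2 : α ≤ 2) {h : ℝ} (hh : 0 < h)
    {f G r : ℝ → ℂ} (hfG : IsFracDeriv α f G) (hr : Integrable r)
    (hrk : ∀ k : ℝ, k ≠ 0 → fourierHat r k = (schemeSymbol α (h * k) - 1) * fourierHat G k) :
    ∫ x : ℝ, ‖scheme α h f x - G x‖ = ∫ x : ℝ, ‖r x‖ := by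
  have hS := integrable_scheme h1 h2 h hfG.1
  have hae := ae_eq_of_fourierHat_eq (hS.sub hfG.2.1) hr fun k hk => by
    rw [hrk k hk, sub_one_mul, ← fourierHat_scheme_of_isFracDeriv h1 h2 hh hfG hk]
    exact fourierHat_sub hS hfG.2.1 k
  refine integral_congr_ae ?_
  filter_upwards [hae] with x hx
  rw [← hx]
  rfl

/-! ### Fractional derivatives of lower order -/

/-- The candidate is `(ik)^α ℓ` applied to `f` plus `(ik)^(-β)(1 - ℓ)` applied to `F`, with `ℓ` the
filter `lowPass`. -/
theorem exists_isFracDeriv_of_add {α β : ℝ} (h0 : 0 < α) (h2 : α ≤ 2) (hβ0 : 0 ≤ β) (hβ2 : β ≤ 2)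
    {f F : ℝ → ℂ} (hF : IsFracDeriv (α + β) f F) : ∃ G : ℝ → ℂ, IsFracDeriv α f G := by
  obtain ⟨L, hL⟩ := exists_isL1Multiplier_low h0.le h2
  obtain ⟨H, hH⟩ := exists_isL1Multiplier_high hβ0 hβ2
  obtain ⟨g, hg, hgk, -⟩ := hL.2 f hF.1
  obtain ⟨g', hg', hgk', -⟩ := hH.2 F hF.2.1
  refine ⟨fun x => g x + g' x, hF.1, hg.add hg', ?_⟩
  have hα : 0 < (α : ℂ).re := by simpa using h0
  -- Multipliers give the identity only for `k ≠ 0`; continuity of both sides, which uses `α > 0`,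
  -- supplies `k = 0`.
  have hcont : Continuous fun k : ℝ => (Complex.I * (k : ℂ)) ^ (α : ℂ) * fourierHat f k := by
    refine Continuous.mul ?_ (continuous_fourierHat hF.1)
    rw [continuous_iff_continuousAt]
    intro k
    rcases eq_or_ne k 0 with rfl | hk
    · have hα' : (α : ℂ) ≠ 0 := by exact_mod_cast h0.ne'
      have : Tendsto (fun k : ℝ => |k| ^ α) (𝓝 0) (𝓝 0) := by
        have hc : Continuous fun t : ℝ => |t| ^ α :=
          continuous_abs.rpow_const fun x => Or.inr h0.le
        simpa [Real.zero_rpow h0.ne'] using hc.tendsto 0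
      rw [ContinuousAt, Complex.ofReal_zero, mul_zero, Complex.zero_cpow hα',
        tendsto_zero_iff_norm_tendsto_zero]
      simpa only [norm_I_mul_ofReal_cpow] using this
    · exact (hasDerivAt_I_mul_ofReal_cpow hk α).continuousAt
  refine congrFun ((continuous_fourierHat (hg.add hg')).ext_on (dense_compl_singleton 0) hcont
    fun k hk => ?_)
  have hk' : k ≠ 0 := hk
  change fourierHat (fun x => g x + g' x) k = _
  have e : (Complex.I * (k : ℂ)) ^ (-β : ℂ) * (Complex.I * (k : ℂ)) ^ ((α + β : ℝ) : ℂ) =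
      (Complex.I * (k : ℂ)) ^ (α : ℂ) := by
    rw [← Complex.cpow_add _ _ (I_mul_ofReal_ne_zero hk')]
    congr 1
    push_cast
    ring
  rw [fourierHat_add hg hg', hgk k hk', hgk' k hk', hF.2.2 k]
  linear_combination ((1 - lowPass k) * fourierHat f k) * e

/-! ### Density of Schwartz functions -/

theorem exists_schwartz_integral_norm_sub_lt {G : ℝ → ℂ} (hG : Integrable G) {ε : ℝ} (hε : 0 < ε) :
    ∃ g : 𝓢(ℝ, ℂ), ∫ x, ‖G x - g x‖ < ε := by
  obtain ⟨g, hg⟩ := (SchwartzMap.denseRange_toLpCLM (E := ℝ) (F := ℂ) (μ := volume)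
    (p := 1) ENNReal.one_ne_top).exists_dist_lt (hG.toL1 G) hε
  refine ⟨g, ?_⟩
  rw [dist_eq_norm, L1.norm_eq_integral_norm] at hg
  refine lt_of_eq_of_lt (integral_congr_ae ?_) hg
  filter_upwards [Lp.coeFn_sub (hG.toL1 G) (g.toLp 1), hG.coeFn_toL1, g.coeFn_toLp 1] with x h1 h2 h3
  have : (hG.toL1 G - SchwartzMap.toLpCLM ℝ ℂ 1 volume g) x = G x - g x := by
    rw [← h2, ← h3]
    exact h1
  rw [← this]

theorem fourierHat_deriv_schwartz (g : 𝓢(ℝ, ℂ)) (k : ℝ) :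
    fourierHat (deriv g) k = Complex.I * k * fourierHat g k := by
  have h := Real.fourier_deriv g.integrable g.differentiable
    (SchwartzMap.derivCLM ℂ ℂ g).integrable
  rw [fourierHat_eq_fourier, h, fourierHat_eq_fourier]
  have : (Real.pi : ℂ) ≠ 0 := by exact_mod_cast Real.pi_ne_zero
  simp only [smul_eq_mul]
  push_cast
  field_simp

/-! ### Error bound and convergence of the scheme -/

theorem theorem3p1 (α : ℝ) (hα₁ : 1 < α) (hα₂ : α ≤ 2) :
    (∀ β : ℝ, 0 ≤ β → β ≤ α →
      ∃ C : ℝ, 0 < C ∧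
        ∀ f F : ℝ → ℂ, IsFracDeriv (α + β) f F →
          (∃ G : ℝ → ℂ, IsFracDeriv α f G) ∧
          ∀ G : ℝ → ℂ, IsFracDeriv α f G →
            ∀ h : ℝ, 0 < h →
              (∀ᵐ x : ℝ, Summable fun m : ℕ =>
                (schemeWeight α m : ℂ) * f (x - ((m : ℝ) - 1) * h)) ∧
              Integrable (scheme α h f) ∧
              ∫ x : ℝ, ‖scheme α h f x - G x‖ ≤ C * h ^ β * ∫ x : ℝ, ‖F x‖) ∧
    (∀ f G : ℝ → ℂ, IsFracDeriv α f G →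
      Tendsto (fun h : ℝ => ∫ x : ℝ, ‖scheme α h f x - G x‖) (𝓝[>] 0) (𝓝 0)) := by
  refine ⟨fun β hβ0 hβ => ?_, fun f G hfG => ?_⟩
  · obtain ⟨C, hC⟩ := exists_isL1Multiplier_symbol_sub_one hα₁ hα₂ hβ0 hβ
    -- The multiplier constant is only known to be nonnegative; adding one makes it positive.
    refine ⟨C + 1, by linarith [hC.1], fun f F hF => ⟨exists_isFracDeriv_of_add (by linarith) hα₂
      hβ0 (hβ.trans hα₂) hF, fun G hG h hh => ⟨ae_summable_scheme hα₁ hα₂ h hF.1,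
      integrable_scheme hα₁ hα₂ h hF.1, ?_⟩⟩⟩
    -- Since `(ihk)^(-β) = h^(-β) (ik)^(-β)`, the function `h^β r` has the transform of the error.
    obtain ⟨r, hr, hrk, hrn⟩ := (hC.comp_mul hh).2 F hF.2.1
    have hhβ : 0 < h ^ β := Real.rpow_pos_of_pos hh β
    have key := integral_norm_scheme_sub_eq hα₁ hα₂ hh hG (hr.const_mul ((h ^ β : ℝ) : ℂ))
      fun k hk => by
        have e1 : ((h ^ β : ℝ) : ℂ) * ((h ^ (-β) : ℝ) : ℂ) = 1 := by
          rw [← Complex.ofReal_mul, ← Real.rpow_add hh, add_neg_cancel, Real.rpow_zero,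
            Complex.ofReal_one]
        have e2 : (Complex.I * (k : ℂ)) ^ ((-β : ℝ) : ℂ) *
            (Complex.I * (k : ℂ)) ^ ((α + β : ℝ) : ℂ) = (Complex.I * (k : ℂ)) ^ (α : ℂ) := by
          rw [← Complex.cpow_add _ _ (I_mul_ofReal_ne_zero hk)]
          congr 1
          push_cast
          ring
        rw [fourierHat_const_mul, hrk k hk]
        beta_reduce
        rw [← Complex.ofReal_neg, mul_I_cpow hh hk, hF.2.2 k,
          hG.2.2 k, ← e2]
        linear_combination (schemeSymbol α (h * k) - 1) * ((Complex.I * (k : ℂ)) ^ ((-β : ℝ) : ℂ) *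
            (Complex.I * (k : ℂ)) ^ ((α + β : ℝ) : ℂ)) * fourierHat f k * e1
    rw [key]
    simp only [norm_mul, Complex.norm_real, Real.norm_of_nonneg hhβ.le]
    rw [integral_const_mul]
    have hF0 : 0 ≤ ∫ x, ‖F x‖ := integral_nonneg fun x => norm_nonneg _
    calc h ^ β * ∫ x, ‖r x‖ ≤ h ^ β * (C * ∫ x, ‖F x‖) := mul_le_mul_of_nonneg_left hrn hhβ.le
      _ ≤ (C + 1) * h ^ β * ∫ x, ‖F x‖ := by nlinarith [mul_nonneg hhβ.le hF0]
  · obtain ⟨A, hA⟩ := exists_isL1Multiplier_schemeSymbol hα₁ hα₂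
    have hB := hA.add (IsL1Multiplier.const (-1))
    set B := A + ‖(-1 : ℂ)‖ with hBdef
    -- The exponent `β = 1` is admissible because `1 < α`, and it needs only an ordinary derivative
    -- of the approximant.
    obtain ⟨C, hC⟩ := exists_isL1Multiplier_symbol_sub_one hα₁ hα₂ zero_le_one hα₁.le
    rw [Metric.tendsto_nhds]
    intro ε hε
    -- The approximation is of `G` itself: the multiplier acts on `G` directly, so `g` need not be a
    -- fractional derivative. The `+ 1` here and in the bound on `h` keeps denominators positive.
    obtain ⟨g, hg⟩ := exists_schwartz_integral_norm_sub_lt hfG.2.1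
      (ε := ε / (2 * (B + 1))) (div_pos hε (by linarith [hB.1]))
    have hg' : Integrable (deriv g) := (SchwartzMap.derivCLM ℂ ℂ g).integrable
    set D := ∫ x, ‖deriv g x‖ with hD
    have hD0 : 0 ≤ D := integral_nonneg fun x => norm_nonneg _
    have hδ : 0 < ε / (2 * (C * D + 1)) :=
      div_pos hε (by linarith [mul_nonneg hC.1 hD0])
    filter_upwards [Ioo_mem_nhdsGT hδ] with h hh
    obtain ⟨r, hr, hrk, hrn⟩ := (hB.comp_mul hh.1).2 (fun x => G x - g x) (hfG.2.1.sub g.integrable)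
    obtain ⟨q, hq, hqk, hqn⟩ := (hC.comp_mul hh.1).2 (deriv g) hg'
    -- The error is `φ(h·) - 1` applied to `G - g`, which is `r`, plus the same operator applied to
    -- `g`, which is `h q` because `φ(hk) - 1 = h (φ(hk) - 1)(ihk)⁻¹ (ik)`.
    have key := integral_norm_scheme_sub_eq hα₁ hα₂ hh.1 hfG (hr.add (hq.const_mul (h : ℂ)))
      fun k hk => by
        have hs := I_mul_ofReal_ne_zero hk
        have hh' : (h : ℂ) ≠ 0 := by exact_mod_cast hh.1.ne'
        have hk' : (k : ℂ) ≠ 0 := by exact_mod_cast hk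
        refine (fourierHat_add hr (hq.const_mul (h : ℂ)) k).trans ?_
        rw [fourierHat_const_mul, hrk k hk, hqk k hk, fourierHat_sub hfG.2.1 g.integrable,
          fourierHat_deriv_schwartz]
        beta_reduce
        rw [Complex.ofReal_one, Complex.cpow_neg_one]
        push_cast
        field_simp
        ring
    rw [Real.dist_eq, sub_zero, abs_of_nonneg (integral_nonneg fun x => norm_nonneg _), key]
    have l1 : ∫ x, ‖(r + fun x => (h : ℂ) * q x) x‖ ≤ (∫ x, ‖r x‖) + h * ∫ x, ‖q x‖ := by
      rw [← integral_const_mul, ← integral_add hr.norm (hq.norm.const_mul h)]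
      refine integral_mono (hr.add (hq.const_mul (h : ℂ))).norm
        (hr.norm.add (hq.norm.const_mul h)) fun x => ?_
      refine (norm_add_le _ _).trans (le_of_eq ?_)
      simp [abs_of_pos hh.1]
    have l2 : B * ∫ x, ‖G x - g x‖ ≤ ε / 2 := by
      have hB1 : 0 < B + 1 := by linarith [hB.1]
      calc B * ∫ x, ‖G x - g x‖ ≤ (B + 1) * (ε / (2 * (B + 1))) :=
            mul_le_mul (by linarith) hg.le (integral_nonneg fun x => norm_nonneg _) hB1.le
        _ = ε / 2 := by field_simp
    have l3 : h * (C * D) < ε / 2 := by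
      have hCD := mul_nonneg hC.1 hD0
      have := hh.2
      rw [lt_div_iff₀ (by linarith)] at this
      nlinarith [hh.1]
    have l4 : h * ∫ x, ‖q x‖ ≤ h * (C * D) := mul_le_mul_of_nonneg_left hqn hh.1.le
    linarith
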